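/- Let $(n,m)\in\{(2,2),(3,4),(5,8)\}$ and $\hbar>0$. Let $d\Omega$ be the normalized surface measure on the unit sphere $S^n\subset\mathbb R^{n+1}$, and let $\langle\phi,\psi\rangle=\int_{S^n}\phi\,\overline{\psi}\,d\Omega$ be the inner product of $L^2(S^n)=L^2(S^n,d\Omega)$. Let $\rho=(\rho_1,\dots,\rho_{n+1}):\mathbb C^m\to\mathbb C^{n+1}$ be the map given by - for $(n,m)=(2,2)$: $\rho_1=\tfrac12(z_2^2-z_1^2)$, $\rho_2=\tfrac{i}{2}(z_1^2+z_2^2)$, $\rho_3=z_1z_2$; - for $(n,m)=(3,4)$: $\rho_1=z_1z_3+z_2z_4$, $\rho_2=i(z_1z_3-z_2z_4)$, $\rho_3=i(z_1z_4+z_2z_3)$, $\rho_4=z_1z_4-z_2z_3$; - for $(n,m)=(5,8)$: $\rho_1=i(-z_1z_6+z_3z_8+z_2z_5-z_4z_7)$, $\rho_2=z_1z_6+z_3z_8+z_2z_5+z_4z_7$, $\rho_3=z_2z_6+z_3z_7-z_1z_5-z_4z_8$, $\rho_4=i(-z_1z_5+z_4z_8-z_2z_6+z_3z_7)$, $\rho_5=i(-z_1z_8-z_2z_7-z_3z_6-z_4z_5)$,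 $\rho_6=z_1z_8+z_2z_7-z_3z_6-z_4z_5$. For $z\in\mathbb C^m$ let $\Phi_{\rho(z)}\in L^2(S^n)$ be the coherent state $$\Phi_{\rho(z)}(x)=\sum_{\ell=0}^\infty\frac{\sqrt{2\ell+n-1}}{\ell!\,\sqrt{n-1}}\left(\frac{x\cdot\rho(z)}{\hbar}\right)^{\ell},\qquad x\cdot\alpha=\sum_{s=1}^{n+1}x_s\overline{\alpha_s},\quad x\in S^n,$$ and let $d\mu_\hbar(z)=(\pi\hbar)^{-m}e^{-|z|^2/\hbar}\,dz\,d\overline z$, where $dz\,d\overline z$ is the Lebesgue measure on $\mathbb C^m\simeq\mathbb R^{2m}$. Then the coherent states form a complete system in $L^2(S^n)$: the linear span of $\{\Phi_{\rho(z)} : z\in\mathbb C^m\setminus\{0\}\}$ is dense in $L^2(S^n)$, and for all $\phi,\psi\in L^2(S^n)$ the function $z\mapsto\langle\phi,\Phi_{\rho(z)}\rangle\langle\Phi_{\rho(z)},\psi\rangle$ is $\mu_\hbar$-integrable on $\mathbb C^m$ and $$\langle\phi,\psi\rangle=\int_{\mathbb C^m}\langle\phi,\Phi_{\rho(z)}\rangle\,\langle\Phi_{\rho(z)},\psi\rangle\,d\mu_\hbar(z).$$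 -/

import Mathlib

open MeasureTheory
open scoped ComplexConjugate

noncomputable section

/-- The three admissible pairs `(n, m) = (2, 2), (3, 4), (5, 8)`. -/
inductive SphereCase where
  | two
  | three
  | five

namespace SphereCase

/-- The dimension `n` of the sphere. -/
def n : SphereCase → ℕ
  | two => 2
  | three => 3
  | five => 5

/-- The dimension `m` of the complex label space `ℂ^m`. -/
def m : SphereCase → ℕ
  | two => 2
  | three => 4
  | five => 8

/-- The quadratic map `ρ_{(n,m)} : ℂ^m → ℂ^{n+1}`; the coordinates `z_1, …, z_m` are
`z 0, …, z (m-1)`. -/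
def rho : (c : SphereCase) → (Fin c.m → ℂ) → (Fin (c.n + 1) → ℂ)
  | two => fun (z : Fin 2 → ℂ) =>
      (![(1 / 2) * ((z 1) ^ 2 - (z 0) ^ 2),
        (Complex.I / 2) * ((z 0) ^ 2 + (z 1) ^ 2),
        z 0 * z 1] : Fin 3 → ℂ)
  | three => fun (z : Fin 4 → ℂ) =>
      (![z 0 * z 2 + z 1 * z 3,
        Complex.I * (z 0 * z 2 - z 1 * z 3),
        Complex.I * (z 0 * z 3 + z 1 * z 2),
        z 0 * z 3 - z 1 * z 2] : Fin 4 → ℂ)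
  | five => fun (z : Fin 8 → ℂ) =>
      (![Complex.I * (-(z 0 * z 5) + z 2 * z 7 + z 1 * z 4 - z 3 * z 6),
        z 0 * z 5 + z 2 * z 7 + z 1 * z 4 + z 3 * z 6,
        z 1 * z 5 + z 2 * z 6 - z 0 * z 4 - z 3 * z 7,
        Complex.I * (-(z 0 * z 4) + z 3 * z 7 - z 1 * z 5 + z 2 * z 6),
        Complex.I * (-(z 0 * z 7) - z 1 * z 6 - z 2 * z 5 - z 3 * z 4),
        z 0 * z 7 + z 1 * z 6 - z 2 * z 5 - z 3 * z 4] : Fin 6 → ℂ)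

end SphereCase

/-- The unit sphere `S^n ⊆ ℝ^{n+1}`. -/
abbrev UnitSphere (n : ℕ) : Type :=
  Metric.sphere (0 : EuclideanSpace ℝ (Fin (n + 1))) 1

/-- The normalized surface measure `dΩ` on `S^n`. -/
def sphereMeasure (n : ℕ) : Measure (UnitSphere n) :=
  ((volume : Measure (EuclideanSpace ℝ (Fin (n + 1)))).toSphere Set.univ)⁻¹ •
    (volume : Measure (EuclideanSpace ℝ (Fin (n + 1)))).toSphere

instance sphereMeasure.instIsProbabilityMeasure (n : ℕ) :
    IsProbabilityMeasure (sphereMeasure n) := by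
  constructor
  have h0 : (volume : Measure (EuclideanSpace ℝ (Fin (n + 1)))).toSphere Set.univ ≠ 0 := by
    rw [Ne, Measure.measure_univ_eq_zero]
    exact Measure.toSphere_ne_zero _
  rw [sphereMeasure, Measure.smul_apply, smul_eq_mul]
  exact ENNReal.inv_mul_cancel h0 (measure_ne_top _ _)

/-- The complex Hilbert space `L²(S^n)` with respect to `dΩ`. -/
abbrev L2Sphere (n : ℕ) : Type := Lp ℂ 2 (sphereMeasure n)

/-- The inner product `⟨φ, ψ⟩ = ∫ φ(x) conj(ψ(x)) dΩ(x)` of `L²(S^n)`, linear in the first slot. -/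
def sphereInner {n : ℕ} (φ ψ : L2Sphere n) : ℂ :=
  ∫ x, φ x * conj (ψ x) ∂(sphereMeasure n)

/-- `sphereInner` is Mathlib's inner product with the two arguments exchanged. -/
theorem sphereInner_eq_inner {n : ℕ} (φ ψ : L2Sphere n) :
    sphereInner φ ψ = inner ℂ ψ φ := by
  rw [L2.inner_def]
  rfl

/-- The Hermitian product `x · α = ∑ x_s conj(α_s)` of a point of `S^n` with `α ∈ ℂ^{n+1}`. -/
def sphereDot {n : ℕ} (x : UnitSphere n) (α : Fin (n + 1) → ℂ) : ℂ :=
  ∑ s, ((x.1 s : ℝ) : ℂ) * conj (α s)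

/-- The `ℓ`-th term of the series that defines the coherent state `Φ_α`. -/
def coherentTerm (n : ℕ) (ħ : ℝ) (α : Fin (n + 1) → ℂ) (l : ℕ) (x : UnitSphere n) : ℂ :=
  ((Real.sqrt (2 * (l : ℝ) + (n : ℝ) - 1) / ((l.factorial : ℝ) * Real.sqrt ((n : ℝ) - 1)) : ℝ) : ℂ) *
    (sphereDot x α / (ħ : ℂ)) ^ l

theorem continuous_sphereDot {n : ℕ} (α : Fin (n + 1) → ℂ) :
    Continuous fun x : UnitSphere n => sphereDot x α := by
  unfold sphereDot
  fun_prop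

theorem continuous_coherentTerm (n : ℕ) (ħ : ℝ) (α : Fin (n + 1) → ℂ) (l : ℕ) :
    Continuous (coherentTerm n ħ α l) :=
  continuous_const.mul (((continuous_sphereDot α).div_const _).pow l)

/-- The terms of the series are dominated, uniformly on the sphere, by a summable sequence. -/
theorem coherentTerm_bound (n : ℕ) (ħ : ℝ) (α : Fin (n + 1) → ℂ) :
    ∃ u : ℕ → ℝ, Summable u ∧ ∀ l x, ‖coherentTerm n ħ α l x‖ ≤ u l := by
  obtain ⟨R, hR⟩ : ∃ R : ℝ, ∀ x : UnitSphere n, ‖sphereDot x α / (ħ : ℂ)‖ ≤ R := by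
    obtain ⟨R, hR⟩ := (isCompact_range
      (((continuous_sphereDot α).div_const (ħ : ℂ)).norm)).bddAbove
    exact ⟨R, fun x => hR ⟨x, rfl⟩⟩
  have hsqrt : ∀ l : ℕ, Real.sqrt (2 * (l : ℝ) + (n : ℝ) - 1) ≤ ((n : ℝ) + 2) * 2 ^ l := by
    intro l
    have h1 : (l : ℝ) + 1 ≤ 2 ^ l := by exact_mod_cast Nat.lt_two_pow_self (n := l)
    have hn : (0 : ℝ) ≤ n := Nat.cast_nonneg n
    have hl : (0 : ℝ) ≤ l := Nat.cast_nonneg l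
    rw [Real.sqrt_le_left (by positivity)]
    have h2 : 2 * (l : ℝ) + (n : ℝ) - 1 ≤ ((n : ℝ) + 2) * 2 ^ l := by
      nlinarith [mul_le_mul_of_nonneg_left h1 hn]
    have h3 : (1 : ℝ) ≤ ((n : ℝ) + 2) * 2 ^ l := by
      nlinarith [mul_le_mul_of_nonneg_left h1 hn]
    nlinarith
  refine ⟨fun l => (((n : ℝ) + 2) / Real.sqrt ((n : ℝ) - 1)) * ((2 * |R|) ^ l / (l.factorial : ℝ)),
    (Real.summable_pow_div_factorial (2 * |R|)).mul_left _, fun l x => ?_⟩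
  have hx : ‖sphereDot x α / (ħ : ℂ)‖ ≤ |R| := (hR x).trans (le_abs_self R)
  rw [coherentTerm, norm_mul, norm_pow, Complex.norm_real, Real.norm_of_nonneg (by positivity)]
  calc Real.sqrt (2 * (l : ℝ) + (n : ℝ) - 1) / ((l.factorial : ℝ) * Real.sqrt ((n : ℝ) - 1)) *
        ‖sphereDot x α / (ħ : ℂ)‖ ^ l
      ≤ (((n : ℝ) + 2) * 2 ^ l) / ((l.factorial : ℝ) * Real.sqrt ((n : ℝ) - 1)) * |R| ^ l := by
        gcongr
        exact hsqrt l
    _ = (((n : ℝ) + 2) / Real.sqrt ((n : ℝ) - 1)) * ((2 * |R|) ^ l / (l.factorial : ℝ)) := by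
        rw [mul_pow, div_mul_eq_mul_div, div_mul_div_comm]
        ring_nf

/-- The coherent state
`Φ_α(x) = ∑_ℓ √(2ℓ+n-1) / (ℓ! √(n-1)) · ((x · α) / ħ)^ℓ`, a continuous function on `S^n`. -/
def coherentFun (n : ℕ) (ħ : ℝ) (α : Fin (n + 1) → ℂ) : C(UnitSphere n, ℂ) where
  toFun x := ∑' l : ℕ, coherentTerm n ħ α l x
  continuous_toFun := by
    obtain ⟨u, hu, hb⟩ := coherentTerm_bound n ħ α
    exact continuous_tsum (continuous_coherentTerm n ħ α) hu hb

/-- The coherent state `Φ_{ρ(z)}`, `z ∈ ℂ^m`, as an element of `L²(S^n)`. -/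
def coherentState (c : SphereCase) (ħ : ℝ) (z : Fin c.m → ℂ) : L2Sphere c.n :=
  ContinuousMap.toLp 2 (sphereMeasure c.n) ℂ (coherentFun c.n ħ (c.rho z))

/-- The Gaussian measure `dμ_ħ(z) = (πħ)^{-m} exp(-|z|²/ħ) dz dz̄` on `ℂ^m`, where `dz dz̄` is the
Lebesgue measure of `ℂ^m = ℝ^{2m}`. -/
def bargmannMeasure (m : ℕ) (ħ : ℝ) : Measure (Fin m → ℂ) :=
  (volume : Measure (Fin m → ℂ)).withDensity fun z =>
    ENNReal.ofReal (((Real.pi * ħ) ^ m)⁻¹ * Real.exp (-(∑ j, ‖z j‖ ^ 2) / ħ))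

end

/-! Call `a` null if `∑ a_s² = 0`, and write `a·x` for the bilinear product. The proof evaluates
both sides on the powers `(a·x)^l` with `a` null, and then extends by density.

On the sphere, powers of different degree are orthogonal, and equal degrees pair to `l! / ∏_{j<l}
(n+1+2j) · (a·b̄)^l` (`integral_sphereDot_pow`). This comes from Gaussian integration by parts on
`ℝ^{n+1}`, where nullity leaves only the contractions of `a` with `b̄`, followed by polar
coordinates. Since `ρ(z)` is null, the coherent state sees only its `l`-th term, and its pairing
with `(a·x)^l` is a constant times `(a·ρ(z))^l` (`inner_coherentState_powerState`).

On `ℂ^m`, `a·ρ(z)` is a quadratic form, and in the Fischer product multiplication by a quadratic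
form is adjoint to a second order operator. The matrices of `ρ` satisfy Clifford relations, so this
operator lowers powers of `a·ρ` by a scalar, and the powers pair to `ħ^{2l} l! ∏_{j<l} (n-1+2j) ·
(a·b̄)^l` (`integral_rho_pow`). The weights of the coherent state turn one constant into the other
(`pairingCoeff_sq`).

Density of the null powers (`nullPowerSpan_topologicalClosure`) follows from Stone–Weierstrass once
their span is shown stable under multiplication by coordinates. `resolution_of_identity_of_dense`
passes to all of `L²`; completeness follows, since a vector orthogonal to almost every coherent
state then has norm zero. -/

/-! ### Quadratic forms under constant-coefficient second order operators. -/

open MvPolynomial in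
/-- The quadratic form `∑ A_ij X_i X_j`. -/
noncomputable def quadForm {m : ℕ} (A : Matrix (Fin m) (Fin m) ℂ) : MvPolynomial (Fin m) ℂ :=
  ∑ i, ∑ j, C (A i j) * (X i * X j)

open MvPolynomial in
/-- The second order operator `∑ B_ij ∂_i ∂_j`. -/
noncomputable def quadDiff {m : ℕ} (B : Matrix (Fin m) (Fin m) ℂ) (p : MvPolynomial (Fin m) ℂ) :
    MvPolynomial (Fin m) ℂ :=
  ∑ i, ∑ j, C (B i j) * pderiv i (pderiv j p)

open MvPolynomial in
theorem pderiv_quadForm {m : ℕ} {A : Matrix (Fin m) (Fin m) ℂ} (hA : A.IsSymm) (k : Fin m) :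
    pderiv k (quadForm A) = 2 * ∑ j, C (A k j) * X j := by
  have h : ∀ i j, A i j = A j i := fun i j => (hA.apply i j).symm
  simp only [quadForm, map_sum, Derivation.leibniz, pderiv_C, pderiv_X, smul_eq_mul, mul_zero,
    add_zero, mul_add, Finset.sum_add_distrib, Pi.single_apply, mul_ite, mul_one]
  rw [two_mul]
  congr 1
  · rw [Finset.sum_comm]
    simp [h k]
  · simp

open MvPolynomial in
theorem pderiv_pderiv_quadForm {m : ℕ} {A : Matrix (Fin m) (Fin m) ℂ} (hA : A.IsSymm)
    (i k : Fin m) : pderiv i (pderiv k (quadForm A)) = 2 * C (A i k) := by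
  rw [pderiv_quadForm hA, two_mul, two_mul, map_add]
  have h : ∀ i j, A i j = A j i := fun i j => (hA.apply i j).symm
  simp [Derivation.leibniz, pderiv_X, Pi.single_apply, h i]

theorem sum_sum_comm_sum_sum {α β R : Type*} [Fintype α] [Fintype β] [AddCommMonoid R]
    (f : α → α → β → β → R) :
    ∑ i, ∑ j, ∑ k, ∑ l, f i j k l = ∑ k, ∑ l, ∑ i, ∑ j, f i j k l := by
  calc _ = ∑ p : α × α, ∑ q : β × β, f p.1 p.2 q.1 q.2 := by simp only [Fintype.sum_prod_type]
    _ = ∑ q : β × β, ∑ p : α × α, f p.1 p.2 q.1 q.2 := Finset.sum_comm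
    _ = _ := by simp only [Fintype.sum_prod_type]

theorem sum_sum_mul_add_mul {α R : Type*} [Fintype α] [CommSemiring R] (b u v : α → α → R)
    (x y : R) : ∑ i, ∑ j, b i j * (x * u i j + y * v i j) =
      x * ∑ i, ∑ j, b i j * u i j + y * ∑ i, ∑ j, b i j * v i j := by
  simp only [Finset.mul_sum, ← Finset.sum_add_distrib]
  refine Finset.sum_congr rfl fun i _ => Finset.sum_congr rfl fun j _ => ?_
  ring

-- Second derivatives of `q^(l+1)` give `q^l ∂ᵢ∂ⱼq` and `q^(l-1) ∂ᵢq ∂ⱼq`. Contracted with `B`, the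
-- first yields the trace `τ`; the second yields the form of `4ABA`, which `hκ` turns back into a
-- multiple of `q`.
open MvPolynomial in
theorem quadDiff_quadForm_pow {m : ℕ} {A B : Matrix (Fin m) (Fin m) ℂ} (hA : A.IsSymm)
    {κ τ : ℂ} (hκ : A * B * A = κ • A) (hτ : 2 * (B * A).trace = τ) (l : ℕ) :
    quadDiff B (quadForm A ^ (l + 1)) =
      C ((l + 1) * (τ + 4 * κ * l)) * quadForm A ^ l := by
  have hs : ∀ i j, A i j = A j i := fun i j => (hA.apply i j).symm
  have h1 : ∑ i, ∑ j, C (B i j) * (2 * C (A i j)) = (C τ : MvPolynomial (Fin m) ℂ) := by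
    rw [← hτ, Matrix.trace]
    simp only [Matrix.diag, Matrix.mul_apply, map_mul, map_sum, Finset.mul_sum]
    refine Finset.sum_congr rfl fun i _ => Finset.sum_congr rfl fun j _ => ?_
    rw [hs i j]
    simp only [map_ofNat]
    ring
  have h2 : ∑ i, ∑ j, C (B i j) * ((2 * ∑ k, C (A i k) * X k) * (2 * ∑ k, C (A j k) * X k)) =
      4 * C κ * quadForm A := by
    have h3 : ∀ k k', ∑ i, ∑ j, A k i * B i j * A j k' = κ * A k k' := by
      intro k k'
      have := congrFun (congrFun hκ k) k'
      simp only [Matrix.mul_apply, Matrix.smul_apply, smul_eq_mul, Finset.sum_mul] at this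
      rw [← this, Finset.sum_comm]
    have h4 : quadForm A * (4 * C κ) = ∑ k, ∑ k', 4 * C (κ * A k k') * (X k * X k') := by
      simp only [quadForm, Finset.sum_mul, map_mul]
      refine Finset.sum_congr rfl fun i _ => Finset.sum_congr rfl fun j _ => ?_
      ring
    rw [mul_comm, h4]
    simp only [← h3, map_sum, map_mul, Finset.mul_sum, Finset.sum_mul]
    calc _ = ∑ i, ∑ j, ∑ k, ∑ k', 4 * (C (A k i) * C (B i j) * C (A j k')) * (X k * X k') := by
          refine Finset.sum_congr rfl fun i _ => Finset.sum_congr rfl fun j _ => ?_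
          rw [Finset.sum_comm]
          refine Finset.sum_congr rfl fun k _ => Finset.sum_congr rfl fun k' _ => ?_
          rw [hs k i]
          ring
      _ = _ := by
          rw [sum_sum_comm_sum_sum]
  -- At `l = 0` the truncated exponent `l - 1` is harmless, because its term carries the factor `l`.
  have h5 : ∀ i j, pderiv i (pderiv j (quadForm A ^ (l + 1))) =
      ((l : MvPolynomial (Fin m) ℂ) + 1) * quadForm A ^ l * (2 * C (A i j)) +
        ((l : MvPolynomial (Fin m) ℂ) + 1) * (l : MvPolynomial (Fin m) ℂ) * quadForm A ^ (l - 1) *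
        ((2 * ∑ k, C (A i k) * X k) * (2 * ∑ k, C (A j k) * X k)) := by
    intro i j
    rw [← pderiv_pderiv_quadForm hA, ← pderiv_quadForm hA, ← pderiv_quadForm hA]
    simp only [Derivation.leibniz_pow, Derivation.leibniz, smul_eq_mul, nsmul_eq_mul,
      Nat.add_sub_cancel, Derivation.map_natCast, mul_zero, add_zero]
    push_cast
    ring
  calc quadDiff B (quadForm A ^ (l + 1))
      = ((l : MvPolynomial (Fin m) ℂ) + 1) * quadForm A ^ l * (∑ i, ∑ j, C (B i j) * (2 * C (A i j))) +
        ((l : MvPolynomial (Fin m) ℂ) + 1) * (l : MvPolynomial (Fin m) ℂ) * quadForm A ^ (l - 1) * ∑ i, ∑ j, C (B i j) *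
          ((2 * ∑ k, C (A i k) * X k) * (2 * ∑ k, C (A j k) * X k)) := by
        simp only [quadDiff, h5]
        rw [sum_sum_mul_add_mul]
    _ = _ := by
        rw [h1, h2]
        have hC : ∀ k : ℕ, (C (k : ℂ) : MvPolynomial (Fin m) ℂ) = k := map_natCast C
        simp only [map_mul, map_add, map_one, hC, map_ofNat]
        rcases l with _ | l
        · simp
        · simp only [Nat.add_sub_cancel]
          ring

/-! ### Gaussian moments on `ℂ^m` and the Fischer product. -/

/-- The normalized Gaussian density of variance `ħ` on `ℂ`. -/
noncomputable def gaussDensity (ħ : ℝ) (z : ℂ) : ℝ := (Real.pi * ħ)⁻¹ * Real.exp (-‖z‖ ^ 2 / ħ)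

theorem integral_norm_pow_mul_gaussDensity {ħ : ℝ} (hħ : 0 < ħ) (k : ℕ) :
    ∫ z : ℂ, ‖z‖ ^ k * gaussDensity ħ z = ħ ^ ((k : ℝ) / 2) * Real.Gamma (k / 2 + 1) := by
  have h := Complex.integral_rpow_mul_exp_neg_mul_rpow (p := 2) (q := k) (b := ħ⁻¹) (by norm_num)
    (by have : (0 : ℝ) ≤ k := k.cast_nonneg
        linarith) (by positivity)
  have h2 : ∀ z : ℂ, ‖z‖ ^ k * gaussDensity ħ z =
      (Real.pi * ħ)⁻¹ * (‖z‖ ^ (k : ℝ) * Real.exp (-ħ⁻¹ * ‖z‖ ^ (2 : ℝ))) := by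
    intro z
    rw [gaussDensity, Real.rpow_natCast, Real.rpow_two]
    rw [show -‖z‖ ^ 2 / ħ = -ħ⁻¹ * ‖z‖ ^ 2 by ring]
    ring
  simp_rw [h2]
  rw [integral_const_mul, h, Real.inv_rpow hħ.le, ← Real.rpow_neg hħ.le,
    show -(-((k : ℝ) + 2) / 2) = k / 2 + 1 by ring, Real.rpow_add_one hħ.ne',
    show ((k : ℝ) + 2) / 2 = k / 2 + 1 by ring]
  have := Real.pi_pos
  field_simp

theorem integrable_norm_pow_mul_gaussDensity {ħ : ℝ} (hħ : 0 < ħ) (k : ℕ) :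
    Integrable fun z : ℂ => ‖z‖ ^ k * gaussDensity ħ z := by
  -- A non-integrable function has integral `0` by convention, so a nonzero value of the integral
  -- proves integrability.
  refine not_imp_comm.1 integral_undef ?_
  rw [integral_norm_pow_mul_gaussDensity hħ]
  have := Real.Gamma_pos_of_pos (show 0 < (k : ℝ) / 2 + 1 by positivity)
  positivity

theorem continuous_gaussDensity (ħ : ℝ) : Continuous (gaussDensity ħ) := by
  unfold gaussDensity
  fun_prop

theorem gaussDensity_nonneg {ħ : ℝ} (hħ : 0 < ħ) (z : ℂ) : 0 ≤ gaussDensity ħ z := by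
  have := Real.pi_pos
  unfold gaussDensity
  positivity

theorem integrable_monomial_gaussDensity {ħ : ℝ} (hħ : 0 < ħ) (a b : ℕ) :
    Integrable fun z : ℂ => z ^ a * conj z ^ b * (gaussDensity ħ z : ℂ) := by
  have hc := continuous_gaussDensity ħ
  refine (integrable_norm_pow_mul_gaussDensity hħ (a + b)).mono'
    (Continuous.aestronglyMeasurable (by fun_prop)) (Filter.Eventually.of_forall fun z => ?_)
  rw [norm_mul, norm_mul, norm_pow, norm_pow, RCLike.norm_conj, ← pow_add, Complex.norm_real,
    Real.norm_of_nonneg (gaussDensity_nonneg hħ z)]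

theorem integral_monomial_gaussDensity {ħ : ℝ} (hħ : 0 < ħ) (a b : ℕ) :
    ∫ z : ℂ, z ^ a * conj z ^ b * (gaussDensity ħ z : ℂ) =
      if a = b then ((a.factorial : ℂ) * (ħ : ℂ) ^ a) else 0 := by
  split_ifs with h
  · subst h
    have h2 : ∀ z : ℂ, z ^ a * conj z ^ a * (gaussDensity ħ z : ℂ) =
        ((‖z‖ ^ (2 * a) * gaussDensity ħ z : ℝ) : ℂ) := by
      intro z
      rw [← mul_pow, Complex.mul_conj, Complex.normSq_eq_norm_sq]
      push_cast
      ring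
    simp_rw [h2]
    rw [integral_complex_ofReal, integral_norm_pow_mul_gaussDensity hħ]
    push_cast
    rw [mul_div_cancel_left₀ _ (two_ne_zero' ℝ), Real.Gamma_nat_eq_factorial, Real.rpow_natCast]
    push_cast
    ring
  -- Rotation by `u = exp(iπ/(a-b))` preserves the Gaussian and multiplies the monomial by `-1`, so
  -- its integral vanishes.
  · obtain ⟨u, hu1, hu⟩ : ∃ u : ℂ, ‖u‖ = 1 ∧ u ^ a * conj u ^ b ≠ 1 := by
      have hab : ((a : ℂ) - b) ≠ 0 := sub_ne_zero.2 (by exact_mod_cast h)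
      refine ⟨Complex.exp ((Real.pi / ((a : ℝ) - b) : ℝ) * Complex.I),
        Complex.norm_exp_ofReal_mul_I _, ?_⟩
      rw [← Complex.exp_conj, ← Complex.exp_nat_mul, ← Complex.exp_nat_mul, ← Complex.exp_add]
      simp only [map_mul, Complex.conj_ofReal, Complex.conj_I]
      push_cast
      rw [show (a : ℂ) * (Real.pi / ((a : ℂ) - b) * Complex.I) +
        b * (Real.pi / ((a : ℂ) - b) * -Complex.I) = Real.pi * Complex.I by field_simp; ring]
      rw [Complex.exp_pi_mul_I]
      norm_num
    let e : ℂ ≃ₗᵢ[ℝ] ℂ := rotation ⟨u, by simp [Submonoid.unitSphere, hu1]⟩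
    have he : ∀ z, e z = u * z := fun z => rotation_apply _ _
    have key := e.measurePreserving.integral_comp e.toHomeomorph.measurableEmbedding
      (fun z : ℂ => z ^ a * conj z ^ b * (gaussDensity ħ z : ℂ))
    have h3 : ∀ z : ℂ, (e z) ^ a * conj (e z) ^ b * (gaussDensity ħ (e z) : ℂ) =
        (u ^ a * conj u ^ b) * (z ^ a * conj z ^ b * (gaussDensity ħ z : ℂ)) := by
      intro z
      rw [gaussDensity, LinearIsometryEquiv.norm_map, he, map_mul, gaussDensity]
      ring
    simp_rw [h3] at key
    rw [integral_const_mul] at key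
    by_contra h0
    exact hu (mul_right_cancel₀ h0 (by rw [key, one_mul]))

theorem bargmannMeasure_eq {m : ℕ} (ħ : ℝ) : bargmannMeasure m ħ =
    volume.withDensity fun z => ENNReal.ofReal (∏ j, gaussDensity ħ (z j)) := by
  rw [bargmannMeasure]
  congr 1
  ext z
  simp only [gaussDensity, Finset.prod_mul_distrib, ← Real.exp_sum, Finset.prod_const,
    Finset.card_univ, Fintype.card_fin, neg_div, Finset.sum_neg_distrib, Finset.sum_div, inv_pow]

theorem continuous_prod_gaussDensity {m : ℕ} (ħ : ℝ) :
    Continuous fun z : Fin m → ℂ => ∏ j, gaussDensity ħ (z j) :=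
  continuous_finsetProd _ fun j _ => (continuous_gaussDensity ħ).comp (continuous_apply j)

theorem integrable_bargmannMeasure_iff {m : ℕ} {ħ : ℝ} (hħ : 0 < ħ) (f : (Fin m → ℂ) → ℂ) :
    Integrable f (bargmannMeasure m ħ) ↔
      Integrable fun z => f z * ((∏ j, gaussDensity ħ (z j) : ℝ) : ℂ) := by
  rw [bargmannMeasure_eq, integrable_withDensity_iff_integrable_smul'
    (continuous_prod_gaussDensity ħ).measurable.ennreal_ofReal (by simp)]
  refine integrable_congr (Filter.Eventually.of_forall fun z => ?_)
  simp only
  rw [ENNReal.toReal_ofReal (Finset.prod_nonneg fun j _ => gaussDensity_nonneg hħ _), mul_comm,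
    Complex.real_smul]

theorem integral_bargmannMeasure {m : ℕ} {ħ : ℝ} (hħ : 0 < ħ) (f : (Fin m → ℂ) → ℂ) :
    ∫ z, f z ∂(bargmannMeasure m ħ) =
      ∫ z, f z * ((∏ j, gaussDensity ħ (z j) : ℝ) : ℂ) := by
  rw [bargmannMeasure_eq, integral_withDensity_eq_integral_toReal_smul
    (continuous_prod_gaussDensity ħ).measurable.ennreal_ofReal (by simp)]
  refine integral_congr_ae (Filter.Eventually.of_forall fun z => ?_)
  simp only
  rw [ENNReal.toReal_ofReal (Finset.prod_nonneg fun j _ => gaussDensity_nonneg hħ _), mul_comm,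
    Complex.real_smul]

open MvPolynomial in
theorem eval_monomial_mul_conj_mul_gaussDensity {m : ℕ} (ħ : ℝ) (s t : Fin m →₀ ℕ) (x y : ℂ)
    (z : Fin m → ℂ) :
    eval z (monomial s x) * conj (eval z (monomial t y)) *
        ((∏ j, gaussDensity ħ (z j) : ℝ) : ℂ) =
      x * conj y * ∏ j, (z j ^ s j * conj (z j) ^ t j * (gaussDensity ħ (z j) : ℂ)) := by
  simp only [eval_monomial, Finsupp.prod_fintype, pow_zero, implies_true, map_mul, map_prod,
    map_pow, Finset.prod_mul_distrib, Complex.ofReal_prod]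
  ring

open MvPolynomial in
theorem integrable_eval_mul_conj {m : ℕ} {ħ : ℝ} (hħ : 0 < ħ) (p q : MvPolynomial (Fin m) ℂ) :
    Integrable (fun z => eval z p * conj (eval z q)) (bargmannMeasure m ħ) := by
  induction p using MvPolynomial.induction_on' with
  | add p p' hp hp' =>
    simp only [map_add, add_mul]
    exact hp.add hp'
  | monomial s x =>
    induction q using MvPolynomial.induction_on' with
    | add q q' hq hq' =>
      simp only [map_add, mul_add]
      exact hq.add hq'
    | monomial t y =>
      rw [integrable_bargmannMeasure_iff hħ]
      simp_rw [eval_monomial_mul_conj_mul_gaussDensity]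
      exact (Integrable.fintype_prod fun j =>
        integrable_monomial_gaussDensity hħ (s j) (t j)).const_mul _

open MvPolynomial in
/-- The Fischer product `∫ p(z) conj(q(z)) dμ_ħ(z)`. -/
noncomputable def fischer {m : ℕ} (ħ : ℝ) (p q : MvPolynomial (Fin m) ℂ) : ℂ :=
  ∫ z, eval z p * conj (eval z q) ∂(bargmannMeasure m ħ)

section
variable {m : ℕ} {ħ : ℝ}
open MvPolynomial

theorem fischer_add_left (hħ : 0 < ħ) (p p' q : MvPolynomial (Fin m) ℂ) :
    fischer ħ (p + p') q = fischer ħ p q + fischer ħ p' q := by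
  simp only [fischer, map_add, add_mul]
  exact integral_add (integrable_eval_mul_conj hħ _ _) (integrable_eval_mul_conj hħ _ _)

theorem fischer_add_right (hħ : 0 < ħ) (p q q' : MvPolynomial (Fin m) ℂ) :
    fischer ħ p (q + q') = fischer ħ p q + fischer ħ p q' := by
  simp only [fischer, map_add, mul_add]
  exact integral_add (integrable_eval_mul_conj hħ _ _) (integrable_eval_mul_conj hħ _ _)

theorem fischer_C_mul_left (a : ℂ) (p q : MvPolynomial (Fin m) ℂ) :
    fischer ħ (C a * p) q = a * fischer ħ p q := by
  simp only [fischer, map_mul, eval_C, mul_assoc, integral_const_mul]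

theorem fischer_C_mul_right (a : ℂ) (p q : MvPolynomial (Fin m) ℂ) :
    fischer ħ p (C a * q) = conj a * fischer ħ p q := by
  simp only [fischer, map_mul, eval_C, mul_left_comm _ (conj a), integral_const_mul]

theorem conj_fischer (p q : MvPolynomial (Fin m) ℂ) :
    conj (fischer ħ p q) = fischer ħ q p := by
  rw [fischer, ← integral_conj, fischer]
  simp only [map_mul, Complex.conj_conj, mul_comm]

theorem fischer_monomial (hħ : 0 < ħ) (s t : Fin m →₀ ℕ) (x y : ℂ) :
    fischer ħ (monomial s x) (monomial t y) =
      if s = t then x * conj y * ∏ j, ((s j).factorial * (ħ : ℂ) ^ s j) else 0 := by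
  rw [fischer, integral_bargmannMeasure hħ]
  simp_rw [eval_monomial_mul_conj_mul_gaussDensity]
  rw [integral_const_mul, integral_fintype_prod_volume_eq_prod
    (f := fun j z => z ^ s j * conj z ^ t j * (gaussDensity ħ z : ℂ))]
  simp_rw [integral_monomial_gaussDensity hħ]
  split_ifs with h
  · simp [h]
  · obtain ⟨j, hj⟩ := DFunLike.ne_iff.1 h
    rw [Finset.prod_eq_zero (Finset.mem_univ j) (if_neg hj), mul_zero]

theorem fischer_zero_left (q : MvPolynomial (Fin m) ℂ) : fischer ħ 0 q = 0 := by
  simp [fischer]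

theorem fischer_one_one (hħ : 0 < ħ) : fischer ħ (1 : MvPolynomial (Fin m) ℂ) 1 = 1 := by
  have := fischer_monomial hħ (0 : Fin m →₀ ℕ) 0 1 1
  simpa using this

theorem fischer_sum_left (hħ : 0 < ħ) {ι : Type*} (s : Finset ι)
    (p : ι → MvPolynomial (Fin m) ℂ) (q : MvPolynomial (Fin m) ℂ) :
    fischer ħ (∑ i ∈ s, p i) q = ∑ i ∈ s, fischer ħ (p i) q :=
  map_sum (AddMonoidHom.mk' (fischer ħ · q) fun p p' => fischer_add_left hħ p p' q) p s

theorem fischer_sum_right (hħ : 0 < ħ) {ι : Type*} (s : Finset ι)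
    (p : MvPolynomial (Fin m) ℂ) (q : ι → MvPolynomial (Fin m) ℂ) :
    fischer ħ p (∑ i ∈ s, q i) = ∑ i ∈ s, fischer ħ p (q i) :=
  map_sum (AddMonoidHom.mk' (fischer ħ p) fun q q' => fischer_add_right hħ p q q') q s

/-- Multiplication by `X_j` is adjoint to `ħ ∂_j`. -/
theorem fischer_X_mul_right (hħ : 0 < ħ) (j : Fin m) (p q : MvPolynomial (Fin m) ℂ) :
    fischer ħ p (X j * q) = ħ * fischer ħ (pderiv j p) q := by
  induction p using MvPolynomial.induction_on' with
  | add p p' hp hp' => simp only [map_add, fischer_add_left hħ, hp, hp', mul_add]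
  | monomial s x =>
    induction q using MvPolynomial.induction_on' with
    | add q q' hq hq' => simp only [mul_add, fischer_add_right hħ, hq, hq']
    | monomial t y =>
      rw [pderiv_monomial, X, monomial_mul, one_mul, fischer_monomial hħ, fischer_monomial hħ]
      by_cases h : s = Finsupp.single j 1 + t
      · have h' : s - Finsupp.single j 1 = t := by rw [h, add_tsub_cancel_left]
        rw [if_pos h, if_pos h', h']
        have h1 : ∀ i, i ≠ j → s i = t i := by
          intro i hi
          simp [h, hi.symm]
        have h2 : s j = t j + 1 := by simp [h, add_comm]
        rw [← Finset.mul_prod_erase _ _ (Finset.mem_univ j),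
          ← Finset.mul_prod_erase _ (fun i => (((t i).factorial : ℂ) * (ħ : ℂ) ^ t i))
            (Finset.mem_univ j), h2,
          Finset.prod_congr rfl fun i hi => by rw [h1 i (Finset.ne_of_mem_erase hi)],
          Nat.factorial_succ, pow_succ]
        push_cast
        ring
      · rw [if_neg h]
        -- If `s j = 0`, truncated subtraction may still produce `t`, but then the coefficient of
        -- the derivative is zero.
        by_cases h0 : s j = 0
        · simp [h0]
        · rw [if_neg, mul_zero]
          intro h'
          apply h
          rw [← h', add_tsub_cancel_of_le]
          exact Finsupp.single_le_iff.2 (Nat.one_le_iff_ne_zero.2 h0)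

theorem fischer_quadForm_mul_right (hħ : 0 < ħ) {A : Matrix (Fin m) (Fin m) ℂ}
    (hA : A.IsSymm) (p q : MvPolynomial (Fin m) ℂ) :
    fischer ħ p (quadForm A * q) = ħ ^ 2 * fischer ħ (quadDiff (A.map conj) p) q := by
  simp only [quadForm, quadDiff, Finset.sum_mul, fischer_sum_left hħ, fischer_sum_right hħ,
    Finset.mul_sum, mul_assoc, fischer_C_mul_right, fischer_C_mul_left, fischer_X_mul_right hħ,
    Matrix.map_apply]
  -- Taking adjoints reverses the order of the two derivatives; the symmetry of `A` restores it.
  rw [Finset.sum_comm]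
  refine Finset.sum_congr rfl fun i _ => Finset.sum_congr rfl fun j _ => ?_
  rw [hA.apply i j]
  ring

theorem quadDiff_one (B : Matrix (Fin m) (Fin m) ℂ) : quadDiff B 1 = 0 := by
  simp [quadDiff]

/-- Moving one factor `quadForm B` to the other side lowers both exponents by one. When only one
exponent is positive, the operator meets the constant `1` and kills it; this is the orthogonality.
-/
theorem fischer_quadForm_pow (hħ : 0 < ħ) {A B : Matrix (Fin m) (Fin m) ℂ} (hA : A.IsSymm) (hB : B.IsSymm)
    {κ τ : ℂ} (hκ : A * B.map conj * A = κ • A) (hτ : 2 * (B.map conj * A).trace = τ) (l k : ℕ) :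
    fischer ħ (quadForm A ^ l) (quadForm B ^ k) =
      if l = k then (ħ : ℂ) ^ (2 * l) * l.factorial * ∏ j ∈ Finset.range l, (τ + 4 * κ * j)
      else 0 := by
  induction l generalizing k with
  | zero =>
    rcases k with _ | k
    · simp [fischer_one_one hħ]
    · rw [pow_succ', fischer_quadForm_mul_right hħ hB, pow_zero, quadDiff_one, fischer_zero_left]
      simp
  | succ l ih =>
    rcases k with _ | k
    · rw [pow_zero, ← conj_fischer, pow_succ', fischer_quadForm_mul_right hħ hA, quadDiff_one,
        fischer_zero_left]
      simp
    · rw [pow_succ' _ k, fischer_quadForm_mul_right hħ hB, quadDiff_quadForm_pow hA hκ hτ,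
        fischer_C_mul_left, ih]
      simp only [Nat.add_right_cancel_iff, mul_ite, mul_zero]
      split_ifs
      · rw [Finset.prod_range_succ, Nat.factorial_succ]
        push_cast
        ring
      · rfl

end

/-! ### The Clifford matrices of `ρ`, and Gaussian integrals of powers of `ρ(z) · α`. -/

namespace SphereCase

/-- The position of the only nonzero entry in each row of the matrix of `ρ_s`. -/
def rhoPerm : (c : SphereCase) → Fin (c.n + 1) → Fin c.m → Fin c.m
  | two => (!![0, 1; 0, 1; 1, 0] : Matrix (Fin 3) (Fin 2) (Fin 2))
  | three => (!![2, 3, 0, 1; 2, 3, 0, 1; 3, 2, 1, 0; 3, 2, 1, 0] :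
      Matrix (Fin 4) (Fin 4) (Fin 4))
  | five => (!![5, 4, 7, 6, 1, 0, 3, 2; 5, 4, 7, 6, 1, 0, 3, 2; 4, 5, 6, 7, 0, 1, 2, 3;
      4, 5, 6, 7, 0, 1, 2, 3; 7, 6, 5, 4, 3, 2, 1, 0; 7, 6, 5, 4, 3, 2, 1, 0] :
      Matrix (Fin 6) (Fin 8) (Fin 8))

/-- The nonzero entries of twice the matrix of `ρ_s`. -/
def rhoUnit : (c : SphereCase) → Fin (c.n + 1) → Fin c.m → GaussianInt
  | two => (!![-1, 1; ⟨0, 1⟩, ⟨0, 1⟩; 1, 1] : Matrix (Fin 3) (Fin 2) GaussianInt)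
  | three => (!![1, 1, 1, 1; ⟨0, 1⟩, ⟨0, -1⟩, ⟨0, 1⟩, ⟨0, -1⟩; ⟨0, 1⟩, ⟨0, 1⟩, ⟨0, 1⟩, ⟨0, 1⟩;
      1, -1, -1, 1] : Matrix (Fin 4) (Fin 4) GaussianInt)
  | five => (!![
      ⟨0, -1⟩, ⟨0, 1⟩, ⟨0, 1⟩, ⟨0, -1⟩, ⟨0, 1⟩, ⟨0, -1⟩, ⟨0, -1⟩, ⟨0, 1⟩;
      1, 1, 1, 1, 1, 1, 1, 1;
      -1, 1, 1, -1, -1, 1, 1, -1;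
      ⟨0, -1⟩, ⟨0, -1⟩, ⟨0, 1⟩, ⟨0, 1⟩, ⟨0, -1⟩, ⟨0, -1⟩, ⟨0, 1⟩, ⟨0, 1⟩;
      ⟨0, -1⟩, ⟨0, -1⟩, ⟨0, -1⟩, ⟨0, -1⟩, ⟨0, -1⟩, ⟨0, -1⟩, ⟨0, -1⟩, ⟨0, -1⟩;
      1, 1, -1, -1, -1, -1, 1, 1] : Matrix (Fin 6) (Fin 8) GaussianInt)

/-- Twice the matrix of the quadratic form `ρ_s`. -/
def rhoGauss (c : SphereCase) (s : Fin (c.n + 1)) (i j : Fin c.m) : GaussianInt :=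
  if j = c.rhoPerm s i then c.rhoUnit s i else 0

theorem rhoGauss_symm (c : SphereCase) : ∀ s i j,
    c.rhoGauss s i j = c.rhoGauss s j i := by
  rcases c <;> decide +kernel

/-- Doubling the matrices clears the factors `1/2`, so these relations are finitely many identities
between Gaussian integers, settled by computation. -/
theorem rhoGauss_clifford (c : SphereCase) : ∀ s t i j,
    ∑ k, (c.rhoGauss s i k * star (c.rhoGauss t k j) +
      c.rhoGauss t i k * star (c.rhoGauss s k j)) = if s = t ∧ i = j then 2 else 0 := by
  rcases c <;> decide +kernel

/-- The value `2(n-1)` is `m` in all three cases; this numerical match later produces the factors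
`n-1+2j`. -/
theorem rhoGauss_trace (c : SphereCase) : ∀ s t,
    ∑ i, ∑ j, star (c.rhoGauss s i j) * c.rhoGauss t j i =
      if s = t then 2 * ((c.n : GaussianInt) - 1) else 0 := by
  rcases c <;> decide +kernel



/-- The matrix of the quadratic form `z ↦ ρ(z) · α`. -/
noncomputable def rhoMatrix (c : SphereCase) (α : Fin (c.n + 1) → ℂ) :
    Matrix (Fin c.m) (Fin c.m) ℂ :=
  fun i j => ∑ s, conj (α s) * ((1 / 2) * (c.rhoGauss s i j).toComplex)

theorem rhoMatrix_isSymm (c : SphereCase) (α : Fin (c.n + 1) → ℂ) : (c.rhoMatrix α).IsSymm := by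
  ext i j
  simp only [Matrix.transpose_apply, rhoMatrix]
  exact Finset.sum_congr rfl fun s _ => by rw [c.rhoGauss_symm s j i]

theorem sum_rhoGauss_toComplex_mul (c : SphereCase) (s t : Fin (c.n + 1)) (i j : Fin c.m) :
    ∑ k, ((c.rhoGauss s i k).toComplex * conj (c.rhoGauss t k j).toComplex +
      (c.rhoGauss t i k).toComplex * conj (c.rhoGauss s k j).toComplex) =
      if s = t ∧ i = j then 2 else 0 := by
  have h := congrArg GaussianInt.toComplex (c.rhoGauss_clifford s t i j)
  rw [map_sum] at h
  simp only [map_add, map_mul, GaussianInt.toComplex_star] at h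
  rw [h]
  split_ifs <;> simp [map_ofNat]

theorem sum_rhoGauss_toComplex_trace (c : SphereCase) (s t : Fin (c.n + 1)) :
    ∑ i, ∑ j, conj (c.rhoGauss s i j).toComplex * (c.rhoGauss t j i).toComplex =
      if s = t then 2 * ((c.n : ℂ) - 1) else 0 := by
  have h := congrArg GaussianInt.toComplex (c.rhoGauss_trace s t)
  simp only [map_sum, map_mul, GaussianInt.toComplex_star] at h
  rw [h]
  split_ifs <;> simp [map_ofNat]

theorem conj_rhoMatrix_apply (c : SphereCase) (α : Fin (c.n + 1) → ℂ) (i j : Fin c.m) :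
    conj (c.rhoMatrix α i j) = ∑ s, α s * ((1 / 2) * conj (c.rhoGauss s i j).toComplex) := by
  simp [rhoMatrix, map_ofNat]

theorem two_mul_trace_rhoMatrix (c : SphereCase) (α β : Fin (c.n + 1) → ℂ) :
    2 * ((c.rhoMatrix β).map conj * c.rhoMatrix α).trace =
      ((c.n : ℂ) - 1) * ∑ s, β s * conj (α s) := by
  calc _ = 2 * ∑ i, ∑ j, ∑ s, ∑ t, (1 / 4) * (β s * conj (α t) *
        (conj (c.rhoGauss s i j).toComplex * (c.rhoGauss t j i).toComplex)) := by
        simp only [Matrix.trace, Matrix.diag, Matrix.mul_apply, Matrix.map_apply,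
          conj_rhoMatrix_apply]
        simp only [rhoMatrix, Finset.sum_mul_sum]
        congr 1
        refine Finset.sum_congr rfl fun i _ => Finset.sum_congr rfl fun j _ =>
          Finset.sum_congr rfl fun s _ => Finset.sum_congr rfl fun t _ => ?_
        ring
    _ = 2 * ∑ s, ∑ t, (1 / 4) * (β s * conj (α t) *
        (if s = t then 2 * ((c.n : ℂ) - 1) else 0)) := by
        rw [sum_sum_comm_sum_sum]
        simp only [← sum_rhoGauss_toComplex_trace, Finset.mul_sum]
    _ = _ := by
        simp only [mul_ite, mul_zero, Finset.sum_ite_eq, Finset.mem_univ, if_true, Finset.mul_sum]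
        refine Finset.sum_congr rfl fun s _ => ?_
        ring

/-- The Clifford relations are summed against `conj (α s) * β t`. The second product has conjugated
parameters because `rhoMatrix` is antilinear. -/
theorem rhoMatrix_mul_add (c : SphereCase) (α β : Fin (c.n + 1) → ℂ) :
    c.rhoMatrix α * (c.rhoMatrix β).map conj +
      c.rhoMatrix (fun s => conj (β s)) * (c.rhoMatrix fun s => conj (α s)).map conj =
      ((1 / 2) * ∑ s, β s * conj (α s)) • 1 := by
  ext i j
  calc _ = ∑ k, ∑ s, ∑ t, (1 / 4) * (conj (α s) * β t *
        ((c.rhoGauss s i k).toComplex * conj (c.rhoGauss t k j).toComplex +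
        (c.rhoGauss t i k).toComplex * conj (c.rhoGauss s k j).toComplex)) := by
        simp only [Matrix.add_apply, Matrix.mul_apply, Matrix.map_apply, conj_rhoMatrix_apply]
        simp only [rhoMatrix, Finset.sum_mul_sum, Complex.conj_conj]
        rw [← Finset.sum_add_distrib]
        refine Finset.sum_congr rfl fun k _ => ?_
        rw [Finset.sum_comm (f := fun s t => β s * (1 / 2 * (c.rhoGauss s i k).toComplex) *
          (conj (α t) * (1 / 2 * conj (c.rhoGauss t k j).toComplex)))]
        simp only [← Finset.sum_add_distrib]
        refine Finset.sum_congr rfl fun s _ => ?_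
        refine Finset.sum_congr rfl fun t _ => ?_
        ring
    _ = ∑ s, ∑ t, (1 / 4) * (conj (α s) * β t * (if s = t ∧ i = j then 2 else 0)) := by
        rw [Finset.sum_comm]
        refine Finset.sum_congr rfl fun s _ => ?_
        rw [Finset.sum_comm]
        simp only [← sum_rhoGauss_toComplex_mul, Finset.mul_sum]
    _ = _ := by
        simp only [Matrix.smul_apply, Matrix.one_apply, smul_eq_mul]
        by_cases h : i = j
        · simp only [h, and_true, mul_ite, mul_zero, Finset.sum_ite_eq, Finset.mem_univ, if_true,
            Finset.mul_sum, mul_one]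
          refine Finset.sum_congr rfl fun s _ => ?_
          ring
        · simp [h]

/-- Exchanging the first two factors by the Clifford relation leaves a scalar multiple of `rhoMatrix
α` and a term containing `h3`, which vanishes since `α` is null. -/
theorem rhoMatrix_mul_mul (c : SphereCase) {α : Fin (c.n + 1) → ℂ} (hα : ∑ s, α s ^ 2 = 0)
    (β : Fin (c.n + 1) → ℂ) :
    c.rhoMatrix α * (c.rhoMatrix β).map conj * c.rhoMatrix α =
      ((1 / 2) * ∑ s, β s * conj (α s)) • c.rhoMatrix α := by
  have h1 := c.rhoMatrix_mul_add α β
  have h2 := congrArg (fun X => Matrix.map X conj)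
    (c.rhoMatrix_mul_add (fun s => conj (α s)) α)
  -- With parameters `conj α` and `α`, the two summands of the Clifford relation coincide and its
  -- right side is half of `∑ α_s² = 0`.
  have h3 : (c.rhoMatrix fun s => conj (α s)).map conj * c.rhoMatrix α = 0 := by
    have h4 : ∑ s, α s * conj (conj (α s)) = 0 := by
      simpa only [Complex.conj_conj, ← sq] using hα
    rw [h4, mul_zero, zero_smul] at h2
    have h5 : ∀ X : Matrix (Fin c.m) (Fin c.m) ℂ, (X.map conj).map conj = X := by
      intro X
      ext
      simp
    simp only [Matrix.map_add _ (map_add conj), Matrix.map_mul, h5, Complex.conj_conj,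
      Matrix.map_zero _ (map_zero conj)] at h2
    rw [← two_smul ℂ] at h2
    simpa using h2
  rw [eq_sub_of_add_eq h1, sub_mul, mul_assoc (c.rhoMatrix fun s => conj (β s)), h3, mul_zero,
    sub_zero, smul_mul_assoc, one_mul]

open MvPolynomial in
theorem eval_quadForm_rhoMatrix (c : SphereCase) (α : Fin (c.n + 1) → ℂ) (z : Fin c.m → ℂ) :
    eval z (quadForm (c.rhoMatrix α)) = ∑ s, c.rho z s * conj (α s) := by
  have h1 : ∀ s, ∑ i, ∑ j, (1 / 2) * (c.rhoGauss s i j).toComplex * (z i * z j) = c.rho z s := by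
    intro s
    have h2 : ∑ i, ∑ j, (1 / 2) * (c.rhoGauss s i j).toComplex * (z i * z j) =
        ∑ i, (1 / 2) * (c.rhoUnit s i).toComplex * (z i * z (c.rhoPerm s i)) := by
      refine Finset.sum_congr rfl fun i _ => ?_
      simp [rhoGauss, apply_ite]
    rw [h2]
    clear h2
    rcases c
    · change Fin 3 at s
      change Fin 2 → ℂ at z
      change ∑ i : Fin 2, (1 / 2) * (two.rhoUnit s i).toComplex * (z i * z (two.rhoPerm s i)) = _
      fin_cases s <;>
        simp [Fin.sum_univ_succ, rho, rhoUnit, rhoPerm, GaussianInt.toComplex_def] <;> ring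
    · change Fin 4 at s
      change Fin 4 → ℂ at z
      change ∑ i : Fin 4, (1 / 2) * (three.rhoUnit s i).toComplex * (z i * z (three.rhoPerm s i)) = _
      fin_cases s <;>
        simp [Fin.sum_univ_succ, rho, rhoUnit, rhoPerm, GaussianInt.toComplex_def] <;> ring
    · change Fin 6 at s
      change Fin 8 → ℂ at z
      change ∑ i : Fin 8, (1 / 2) * (five.rhoUnit s i).toComplex * (z i * z (five.rhoPerm s i)) = _
      fin_cases s <;>
        simp [Fin.sum_univ_succ, rho, rhoUnit, rhoPerm, GaussianInt.toComplex_def] <;> ring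
  simp only [quadForm, map_sum, map_mul, eval_C, eval_X, rhoMatrix, Finset.sum_mul, ← h1]
  calc _ = ∑ i, ∑ s, ∑ j, conj (α s) * (1 / 2 * (c.rhoGauss s i j).toComplex) * (z i * z j) :=
        Finset.sum_congr rfl fun i _ => Finset.sum_comm
    _ = _ := by
        rw [Finset.sum_comm]
        refine Finset.sum_congr rfl fun s _ => Finset.sum_congr rfl fun i _ =>
          Finset.sum_congr rfl fun j _ => ?_
        ring

/-- With `P = ∑ β_s conj(α_s)` one has `κ = P/2` and `τ = (n-1)P`, so each factor `τ + 4κj` is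
`(n-1+2j)P`. -/
theorem integral_rho_pow (c : SphereCase) {ħ : ℝ} (hħ : 0 < ħ) {α : Fin (c.n + 1) → ℂ}
    (hα : ∑ s, α s ^ 2 = 0) (β : Fin (c.n + 1) → ℂ) (l k : ℕ) :
    ∫ z, (∑ s, c.rho z s * conj (α s)) ^ l * conj ((∑ s, c.rho z s * conj (β s)) ^ k)
        ∂(bargmannMeasure c.m ħ) =
      if l = k then (ħ : ℂ) ^ (2 * l) * l.factorial *
        (∏ j ∈ Finset.range l, ((c.n : ℂ) - 1 + 2 * j)) * (∑ s, β s * conj (α s)) ^ l else 0 := by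
  have h := fischer_quadForm_pow hħ (c.rhoMatrix_isSymm α) (c.rhoMatrix_isSymm β)
    (c.rhoMatrix_mul_mul hα β) (c.two_mul_trace_rhoMatrix α β) l k
  simp only [fischer, map_pow, eval_quadForm_rhoMatrix] at h ⊢
  rw [h]
  split_ifs
  · rw [mul_assoc _ _ ((∑ s, β s * conj (α s)) ^ l), ← Finset.card_range l, ← Finset.prod_const,
      Finset.card_range, ← Finset.prod_mul_distrib]
    congr 1
    refine Finset.prod_congr rfl fun j _ => ?_
    ring
  · rfl

theorem memLp_rho_pow (c : SphereCase) {ħ : ℝ} (hħ : 0 < ħ) (α : Fin (c.n + 1) → ℂ) (l : ℕ) :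
    MemLp (fun z => (∑ s, c.rho z s * conj (α s)) ^ l) 2 (bargmannMeasure c.m ħ) := by
  have hc : Continuous fun z => (∑ s, c.rho z s * conj (α s)) ^ l := by
    simp only [← eval_quadForm_rhoMatrix, ← map_pow]
    exact MvPolynomial.continuous_eval _
  rw [memLp_two_iff_integrable_sq_norm hc.aestronglyMeasurable]
  have h := (integrable_eval_mul_conj hħ (quadForm (c.rhoMatrix α) ^ l)
    (quadForm (c.rhoMatrix α) ^ l)).norm
  simp only [norm_mul, RCLike.norm_conj, map_pow, norm_pow, eval_quadForm_rhoMatrix, ← sq] at h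
  simpa only [norm_pow] using h

/-- Nullity of `ρ(z)` makes the orthogonality relations on the sphere applicable to the terms of the
coherent state. -/
theorem sum_rho_sq (c : SphereCase) (z : Fin c.m → ℂ) : ∑ s, c.rho z s ^ 2 = 0 := by
  rcases c
  · change Fin 2 → ℂ at z
    change ∑ s : Fin 3, rho two z s ^ 2 = 0
    simp [Fin.sum_univ_succ, rho]
    ring_nf
    simp
    try ring
  · change Fin 4 → ℂ at z
    change ∑ s : Fin 4, rho three z s ^ 2 = 0
    simp [Fin.sum_univ_succ, rho]
    ring_nf
    simp
    try ring
  · change Fin 8 → ℂ at z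
    change ∑ s : Fin 6, rho five z s ^ 2 = 0
    simp [Fin.sum_univ_succ, rho]
    ring_nf
    simp
    try ring

end SphereCase

/-! ### Real Gaussian integrals and the pairing of null powers on the sphere. -/

theorem integrable_pow_mul_exp_neg_sq_half (k : ℕ) :
    Integrable fun x : ℝ => x ^ k * Real.exp (-(x ^ 2 / 2)) := by
  have h := integrable_rpow_mul_exp_neg_mul_sq (b := 1 / 2) (by norm_num) (s := k)
    (by have : (0 : ℝ) ≤ k := k.cast_nonneg
        linarith)
  refine h.congr (Filter.Eventually.of_forall fun x => ?_)
  simp only [Real.rpow_natCast]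
  rw [show -(1 / 2) * x ^ 2 = -(x ^ 2 / 2) by ring]

theorem integral_pow_succ_mul_exp_neg_sq_half (k : ℕ) :
    ∫ x : ℝ, x ^ (k + 1) * Real.exp (-(x ^ 2 / 2)) =
      k * ∫ x : ℝ, x ^ (k - 1) * Real.exp (-(x ^ 2 / 2)) := by
  have hu : ∀ x : ℝ, HasDerivAt (fun x : ℝ => x ^ k) (k * x ^ (k - 1)) x :=
    fun x => hasDerivAt_pow k x
  have hv : ∀ x : ℝ, HasDerivAt (fun x : ℝ => -Real.exp (-(x ^ 2 / 2)))
      (x * Real.exp (-(x ^ 2 / 2))) x := by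
    intro x
    have := (((hasDerivAt_pow 2 x).div_const 2).neg.exp).neg
    refine this.congr_deriv ?_
    simp
    ring
  have h := integral_mul_deriv_eq_deriv_mul_of_integrable (fun x _ => hu x) (fun x _ => hv x)
    ((integrable_pow_mul_exp_neg_sq_half (k + 1)).congr (Filter.Eventually.of_forall fun x => by
      simp only [Pi.mul_apply]; ring))
    (((integrable_pow_mul_exp_neg_sq_half (k - 1)).const_mul (-(k : ℝ))).congr
      (Filter.Eventually.of_forall fun x => by simp only [Pi.mul_apply]; ring))
    ((integrable_pow_mul_exp_neg_sq_half k).neg.congr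
      (Filter.Eventually.of_forall fun x => by simp only [Pi.mul_apply, Pi.neg_apply]; ring))
  rw [← integral_const_mul, ← integral_neg] at *
  convert! h using 3
  all_goals ring

open MvPolynomial in
/-- The unnormalized expectation of a polynomial under the standard Gaussian measure of `ℝ^d`. -/
noncomputable def realGauss {d : ℕ} (p : MvPolynomial (Fin d) ℂ) : ℂ :=
  ∫ x : Fin d → ℝ, eval (fun i => (x i : ℂ)) p *
    ((∏ i, Real.exp (-(x i ^ 2 / 2)) : ℝ) : ℂ)

/-- The linear form `∑ a_i X_i`. -/
noncomputable def linForm {d : ℕ} (a : Fin d → ℂ) : MvPolynomial (Fin d) ℂ :=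
  ∑ i, MvPolynomial.C (a i) * MvPolynomial.X i

section
variable {d : ℕ}
open MvPolynomial

theorem eval_monomial_mul_exp (s : Fin d →₀ ℕ) (a : ℂ) (x : Fin d → ℝ) :
    eval (fun i => (x i : ℂ)) (monomial s a) * ((∏ i, Real.exp (-(x i ^ 2 / 2)) : ℝ) : ℂ) =
      a * ((∏ i, (x i ^ s i * Real.exp (-(x i ^ 2 / 2))) : ℝ) : ℂ) := by
  simp only [eval_monomial, Finsupp.prod_fintype, pow_zero, implies_true,
    Finset.prod_mul_distrib, Complex.ofReal_prod, Complex.ofReal_mul, Complex.ofReal_pow]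
  ring

theorem integrable_realGauss (p : MvPolynomial (Fin d) ℂ) :
    Integrable fun x : Fin d → ℝ => eval (fun i => (x i : ℂ)) p *
      ((∏ i, Real.exp (-(x i ^ 2 / 2)) : ℝ) : ℂ) := by
  induction p using MvPolynomial.induction_on' with
  | add p p' hp hp' =>
    simp only [map_add, add_mul]
    exact hp.add hp'
  | monomial s a =>
    simp_rw [eval_monomial_mul_exp]
    exact (Integrable.fintype_prod fun j =>
      integrable_pow_mul_exp_neg_sq_half (s j)).ofReal.const_mul _

theorem realGauss_add (p q : MvPolynomial (Fin d) ℂ) :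
    realGauss (p + q) = realGauss p + realGauss q := by
  simp only [realGauss, map_add, add_mul]
  exact integral_add (integrable_realGauss _) (integrable_realGauss _)

theorem realGauss_C_mul (a : ℂ) (p : MvPolynomial (Fin d) ℂ) :
    realGauss (C a * p) = a * realGauss p := by
  simp only [realGauss, map_mul, eval_C, mul_assoc, integral_const_mul]

theorem realGauss_sum {ι : Type*} (s : Finset ι) (p : ι → MvPolynomial (Fin d) ℂ) :
    realGauss (∑ i ∈ s, p i) = ∑ i ∈ s, realGauss (p i) :=
  map_sum (AddMonoidHom.mk' realGauss realGauss_add) p s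

theorem realGauss_monomial (s : Fin d →₀ ℕ) (a : ℂ) :
    realGauss (monomial s a) =
      a * ((∏ i, ∫ x : ℝ, x ^ s i * Real.exp (-(x ^ 2 / 2)) : ℝ) : ℂ) := by
  simp_rw [realGauss, eval_monomial_mul_exp]
  rw [integral_const_mul, integral_complex_ofReal, integral_fintype_prod_volume_eq_prod
    (f := fun j x => x ^ s j * Real.exp (-(x ^ 2 / 2)))]

/-- Gaussian integration by parts. -/
theorem realGauss_X_mul (j : Fin d) (p : MvPolynomial (Fin d) ℂ) :
    realGauss (X j * p) = realGauss (pderiv j p) := by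
  induction p using MvPolynomial.induction_on' with
  | add p q hp hq => simp only [mul_add, map_add, realGauss_add, hp, hq]
  | monomial s a =>
    rw [pderiv_monomial, X, monomial_mul, one_mul, realGauss_monomial, realGauss_monomial,
      ← Finset.mul_prod_erase _ _ (Finset.mem_univ j),
      ← Finset.mul_prod_erase _ (fun i => ∫ x : ℝ, x ^ ((s - Finsupp.single j 1 : Fin d →₀ ℕ) i) *
        Real.exp (-(x ^ 2 / 2))) (Finset.mem_univ j)]
    have h1 : ∀ i ∈ Finset.univ.erase j, ∫ x : ℝ, x ^ ((Finsupp.single j 1 + s : Fin d →₀ ℕ) i) *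
        Real.exp (-(x ^ 2 / 2)) = ∫ x : ℝ, x ^ ((s - Finsupp.single j 1 : Fin d →₀ ℕ) i) *
        Real.exp (-(x ^ 2 / 2)) := by
      intro i hi
      simp [(Finset.ne_of_mem_erase hi).symm]
    rw [Finset.prod_congr rfl h1]
    have h2 : (Finsupp.single j 1 + s : Fin d →₀ ℕ) j = s j + 1 := by simp [add_comm]
    have h3 : (s - Finsupp.single j 1 : Fin d →₀ ℕ) j = s j - 1 := by simp
    rw [h2, h3, integral_pow_succ_mul_exp_neg_sq_half]
    push_cast
    ring

theorem pderiv_linForm (a : Fin d → ℂ) (j : Fin d) : pderiv j (linForm a) = C (a j) := by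
  simp [linForm, Derivation.leibniz, pderiv_X, Pi.single_apply]

theorem realGauss_linForm_mul (a b c : Fin d → ℂ) (l k : ℕ) :
    realGauss (linForm c * (linForm a ^ l * linForm b ^ k)) =
      l * (∑ j, c j * a j) * realGauss (linForm a ^ (l - 1) * linForm b ^ k) +
      k * (∑ j, c j * b j) * realGauss (linForm a ^ l * linForm b ^ (k - 1)) := by
  have h : ∀ j, pderiv j (linForm a ^ l * linForm b ^ k) =
      C (l * a j) * (linForm a ^ (l - 1) * linForm b ^ k) +
      C (k * b j) * (linForm a ^ l * linForm b ^ (k - 1)) := by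
    intro j
    simp only [Derivation.leibniz_pow, Derivation.leibniz, smul_eq_mul, nsmul_eq_mul,
      pderiv_linForm, map_mul, map_natCast]
    ring
  rw [linForm, Finset.sum_mul, realGauss_sum]
  simp only [mul_assoc, realGauss_C_mul, realGauss_X_mul, h, realGauss_add]
  simp only [mul_add, Finset.sum_add_distrib, Finset.mul_sum, Finset.sum_mul]
  congr 1 <;> exact Finset.sum_congr rfl fun j _ => by ring

/-- Wick's rule: contractions of `a` with `a` and of `b` with `b` vanish, so only the `l!` complete
matchings between the two powers contribute. -/
theorem realGauss_linForm_pow {a b : Fin d → ℂ} (ha : ∑ j, a j ^ 2 = 0) (hb : ∑ j, b j ^ 2 = 0)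
    (l k : ℕ) : realGauss (linForm a ^ l * linForm b ^ k) =
      if l = k then l.factorial * (∑ j, a j * b j) ^ l * realGauss (1 : MvPolynomial (Fin d) ℂ)
      else 0 := by
  simp only [sq] at ha hb
  induction l generalizing k with
  | zero =>
    rcases k with _ | k
    · simp
    · have h := realGauss_linForm_mul a b b 0 k
      rw [hb, ← mul_assoc, mul_comm _ (linForm a ^ 0), mul_assoc, ← pow_succ'] at h
      rw [h]
      simp
  | succ l ih =>
    have h := realGauss_linForm_mul a b a l k
    rw [ha, ← mul_assoc, ← pow_succ'] at h
    rw [h]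
    rcases k with _ | k
    · simp
    · rw [Nat.add_sub_cancel, ih]
      simp only [Nat.add_right_cancel_iff, mul_ite, mul_zero]
      split_ifs with hlk
      · subst hlk
        rw [Nat.factorial_succ]
        push_cast
        ring
      · ring

end

theorem integral_pow_mul_exp_Ioi (k : ℕ) :
    ∫ r in Set.Ioi (0 : ℝ), r ^ (k + 2) * Real.exp (-(r ^ 2 / 2)) =
      (k + 1) * ∫ r in Set.Ioi (0 : ℝ), r ^ k * Real.exp (-(r ^ 2 / 2)) := by
  have h : ∀ k : ℕ, ∫ r in Set.Ioi (0 : ℝ), r ^ k * Real.exp (-(r ^ 2 / 2)) =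
      (1 / 2 : ℝ) ^ (-((k : ℝ) + 1) / 2) * (1 / 2) * Real.Gamma ((k + 1) / 2) := by
    intro k
    rw [← integral_rpow_mul_exp_neg_mul_rpow (p := 2) (by norm_num)
      (by have : (0 : ℝ) ≤ k := k.cast_nonneg
          linarith) (by norm_num)]
    refine integral_congr_ae (Filter.Eventually.of_forall fun x => ?_)
    simp only [Real.rpow_natCast, Real.rpow_two]
    rw [show -(1 / 2) * x ^ 2 = -(x ^ 2 / 2) by ring]
  rw [h, h]
  push_cast
  rw [show ((k : ℝ) + 2 + 1) / 2 = (k + 1) / 2 + 1 by ring, Real.Gamma_add_one (by positivity),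
    show -((k : ℝ) + 2 + 1) / 2 = -(k + 1) / 2 - 1 by ring, Real.rpow_sub_one (by norm_num)]
  ring

theorem integral_pow_mul_exp_Ioi_pos (k : ℕ) :
    0 < ∫ r in Set.Ioi (0 : ℝ), r ^ k * Real.exp (-(r ^ 2 / 2)) := by
  rw [setIntegral_pos_iff_support_of_nonneg_ae]
  · have : Function.support (fun r : ℝ => r ^ k * Real.exp (-(r ^ 2 / 2))) ∩ Set.Ioi 0 =
        Set.Ioi 0 := by
      refine Set.inter_eq_right.2 fun r hr => ?_
      have : 0 < r := hr
      exact (by positivity : r ^ k * Real.exp (-(r ^ 2 / 2)) ≠ 0)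
    rw [this]
    simp
  · filter_upwards [ae_restrict_mem measurableSet_Ioi] with r hr
    have : 0 < r := hr
    simp only [Pi.zero_apply]
    positivity
  · exact (integrable_pow_mul_exp_neg_sq_half k).integrableOn

/-- This ratio of radial moments is the source of the denominator in the sphere integrals. -/
theorem integral_pow_add_two_mul_exp_Ioi (n l : ℕ) :
    ∫ r in Set.Ioi (0 : ℝ), r ^ (n + 2 * l) * Real.exp (-(r ^ 2 / 2)) =
      (∏ j ∈ Finset.range l, ((n : ℝ) + 1 + 2 * j)) *
        ∫ r in Set.Ioi (0 : ℝ), r ^ n * Real.exp (-(r ^ 2 / 2)) := by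
  induction l with
  | zero => simp
  | succ l ih =>
    rw [mul_add, mul_one, ← add_assoc, integral_pow_mul_exp_Ioi, ih, Finset.prod_range_succ]
    push_cast
    ring

/-- Polar coordinates for a function homogeneous of degree `N` against the Gaussian weight. -/
theorem integral_homogeneous_mul_exp {n : ℕ} (f : EuclideanSpace ℝ (Fin (n + 1)) → ℂ) (N : ℕ)
    (hf : ∀ r : ℝ, 0 < r → ∀ x, f (r • x) = (r : ℂ) ^ N * f x) :
    ∫ x, f x * (Real.exp (-(‖x‖ ^ 2 / 2)) : ℂ) =
      (∫ x : UnitSphere n, f x.1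
          ∂(volume : Measure (EuclideanSpace ℝ (Fin (n + 1)))).toSphere) *
        ((∫ r in Set.Ioi (0 : ℝ), r ^ (n + N) * Real.exp (-(r ^ 2 / 2)) : ℝ) : ℂ) := by
  set μ : Measure (EuclideanSpace ℝ (Fin (n + 1))) := volume
  have hd : Module.finrank ℝ (EuclideanSpace ℝ (Fin (n + 1))) - 1 = n := by simp
  calc ∫ x, f x * (Real.exp (-(‖x‖ ^ 2 / 2)) : ℂ) ∂μ
      = ∫ x : ({(0)}ᶜ : Set (EuclideanSpace ℝ (Fin (n + 1)))),
          f x.1 * (Real.exp (-(‖x.1‖ ^ 2 / 2)) : ℂ) ∂(μ.comap (↑)) := by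
        rw [integral_subtype_comap (measurableSet_singleton _).compl
          fun x => f x * (Real.exp (-(‖x‖ ^ 2 / 2)) : ℂ), restrict_compl_singleton]
    _ = ∫ y, f y.1.1 * ((y.2.1 ^ N * Real.exp (-(y.2.1 ^ 2 / 2)) : ℝ) : ℂ)
          ∂μ.toSphere.prod (.volumeIoiPow n) := by
        have h := μ.measurePreserving_homeomorphUnitSphereProd.integral_comp
          (Homeomorph.measurableEmbedding _) (fun y => f y.1.1 *
            ((y.2.1 ^ N * Real.exp (-(y.2.1 ^ 2 / 2)) : ℝ) : ℂ))
        rw [hd] at h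
        rw [← h]
        refine integral_congr_ae (Filter.Eventually.of_forall fun x => ?_)
        have hx : (0 : ℝ) < ‖x.1‖ := norm_pos_iff.2 x.2
        simp only [homeomorphUnitSphereProd_apply_snd_coe, homeomorphUnitSphereProd_apply_fst_coe]
        rw [hf _ (inv_pos.2 hx)]
        push_cast
        have : (‖x.1‖ : ℂ) ≠ 0 := by exact_mod_cast hx.ne'
        have h2 : ((‖x.1‖ : ℂ)⁻¹) ^ N * (‖x.1‖ : ℂ) ^ N = 1 := by
          rw [← mul_pow, inv_mul_cancel₀ this, one_pow]
        linear_combination (-(f x.1 * Complex.exp (-((‖x.1‖ : ℂ) ^ 2 / 2)))) * h2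
    _ = (∫ x : UnitSphere n, f x.1 ∂μ.toSphere) *
          ∫ r : Set.Ioi (0 : ℝ), ((r.1 ^ N * Real.exp (-(r.1 ^ 2 / 2)) : ℝ) : ℂ)
            ∂(.volumeIoiPow n) :=
        integral_prod_mul (fun x : UnitSphere n => f x.1)
          (fun r : Set.Ioi (0 : ℝ) => ((r.1 ^ N * Real.exp (-(r.1 ^ 2 / 2)) : ℝ) : ℂ))
    _ = _ := by
        congr 1
        simp only [Measure.volumeIoiPow, ENNReal.ofReal]
        rw [integral_complex_ofReal]
        congr 1
        rw [integral_withDensity_eq_integral_smul,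
          integral_subtype_comap measurableSet_Ioi
            fun a : ℝ => Real.toNNReal (a ^ n) • (a ^ N * Real.exp (-(a ^ 2 / 2))),
          setIntegral_congr_fun measurableSet_Ioi fun x hx => ?_]
        · have hx : (0 : ℝ) < x := hx
          rw [NNReal.smul_def, Real.coe_toNNReal _ (by positivity), smul_eq_mul]
          ring
        · exact (measurable_subtype_coe.pow_const _).real_toNNReal

open MvPolynomial in
theorem realGauss_eq_integral_euclidean {d : ℕ} (p : MvPolynomial (Fin d) ℂ) :
    realGauss p = ∫ x : EuclideanSpace ℝ (Fin d), eval (fun i => (x i : ℂ)) p *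
      (Real.exp (-(‖x‖ ^ 2 / 2)) : ℂ) := by
  rw [realGauss, ← (EuclideanSpace.volume_preserving_symm_measurableEquiv_toLp
    (Fin d)).integral_comp (MeasurableEquiv.measurableEmbedding _)]
  refine integral_congr_ae (Filter.Eventually.of_forall fun x => ?_)
  simp only [EuclideanSpace.norm_sq_eq, Real.norm_eq_abs, sq_abs, Finset.sum_div,
    ← Finset.sum_neg_distrib, Real.exp_sum]
  rfl

open MvPolynomial in
theorem eval_linForm {d : ℕ} (a : Fin d → ℂ) (x : Fin d → ℂ) :
    eval x (linForm a) = ∑ i, a i * x i := by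
  simp [linForm]

theorem integral_sphereMeasure {n : ℕ} (f : UnitSphere n → ℂ) :
    ∫ x, f x ∂(sphereMeasure n) =
      ((((volume : Measure (EuclideanSpace ℝ (Fin (n + 1)))).toSphere.real Set.univ)⁻¹ : ℝ) : ℂ) *
        ∫ x, f x ∂(volume : Measure (EuclideanSpace ℝ (Fin (n + 1)))).toSphere := by
  rw [sphereMeasure, integral_smul_measure, ENNReal.toReal_inv, Complex.real_smul]
  rfl

open MvPolynomial in
/-- Orthogonality relations of the powers `(x · α)^l` with `α` null. -/
theorem integral_sphereDot_pow {n : ℕ} {α β : Fin (n + 1) → ℂ} (hα : ∑ s, α s ^ 2 = 0)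
    (hβ : ∑ s, β s ^ 2 = 0) (l k : ℕ) :
    ∫ x : UnitSphere n, sphereDot x α ^ l * conj (sphereDot x β ^ k) ∂(sphereMeasure n) =
      if l = k then l.factorial / (∏ j ∈ Finset.range l, ((n : ℂ) + 1 + 2 * j)) *
        (∑ s, β s * conj (α s)) ^ l else 0 := by
  have hα' : ∑ s, conj (α s) ^ 2 = 0 := by
    rw [← map_zero conj, ← hα]
    simp
  set σ : Measure (UnitSphere n) := (volume : Measure (EuclideanSpace ℝ (Fin (n + 1)))).toSphere
  have hσ : (σ.real Set.univ : ℂ) ≠ 0 := by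
    rw [Complex.ofReal_ne_zero, measureReal_ne_zero_iff, Ne, Measure.measure_univ_eq_zero]
    exact Measure.toSphere_ne_zero _
  set R : ℕ → ℝ := fun k => ∫ r in Set.Ioi (0 : ℝ), r ^ k * Real.exp (-(r ^ 2 / 2)) with hR
  have hRpos : ∀ k, (R k : ℂ) ≠ 0 := fun k =>
    Complex.ofReal_ne_zero.2 (integral_pow_mul_exp_Ioi_pos k).ne'
  -- The degree zero case expresses the Gaussian mass through the area of the sphere, which later
  -- cancels against the normalization of the measure.
  have h0 : realGauss (1 : MvPolynomial (Fin (n + 1)) ℂ) = σ.real Set.univ * R n := by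
    have h := integral_homogeneous_mul_exp (n := n) (fun _ => 1) 0 (by simp)
    rw [realGauss_eq_integral_euclidean]
    simp only [map_one]
    rw [h]
    simp [R, σ]
  have h1 := integral_homogeneous_mul_exp (n := n)
    (fun x => eval (fun i => (x i : ℂ)) (linForm (fun s => conj (α s)) ^ l * linForm β ^ k))
    (l + k) (by
      intro r _ x
      have hr : ∀ a : Fin (n + 1) → ℂ, ∑ i, a i * (((r • x) i : ℝ) : ℂ) =
          r * ∑ i, a i * (x i : ℂ) := by
        intro a
        rw [Finset.mul_sum]
        refine Finset.sum_congr rfl fun i _ => ?_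
        simp
        ring
      simp only [map_mul, map_pow, eval_linForm, hr]
      ring)
  rw [← realGauss_eq_integral_euclidean, realGauss_linForm_pow hα' hβ, h0] at h1
  have h2 : ∀ x : UnitSphere n, sphereDot x α ^ l * conj (sphereDot x β ^ k) =
      eval (fun i => (x.1 i : ℂ)) (linForm (fun s => conj (α s)) ^ l * linForm β ^ k) := by
    intro x
    simp only [map_mul, map_pow, eval_linForm, sphereDot, map_sum, Complex.conj_conj,
      Complex.conj_ofReal, mul_comm]
  simp_rw [h2]
  rw [integral_sphereMeasure, eq_div_of_mul_eq (hRpos _) h1.symm]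
  split_ifs with hlk
  · subst hlk
    have h3 : (R (n + (l + l)) : ℂ) =
        (∏ j ∈ Finset.range l, ((n : ℂ) + 1 + 2 * j)) * R n := by
      have := integral_pow_add_two_mul_exp_Ioi n l
      rw [two_mul] at this
      simp only [hR, this]
      push_cast
      rfl
    have h4 : (∏ j ∈ Finset.range l, ((n : ℂ) + 1 + 2 * j)) ≠ 0 := by
      intro h
      exact hRpos _ (h3.trans (by rw [h, zero_mul]))
    rw [h3]
    have h5 := hRpos n
    push_cast
    simp only [mul_comm (conj _)]
    field_simp
    exact mul_div_cancel_right₀ _ hσ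
  · simp

/-! ### Density of the powers of null linear forms. -/

/-- A submodule that contains all values of a polynomial contains its coefficients. -/
theorem Submodule.coeff_mem_of_forall_eval_mem {A : Type*} [CommRing A] [Algebra ℂ A]
    (D : Submodule ℂ A) (p : Polynomial A) (h : ∀ t : ℂ, p.eval (algebraMap ℂ A t) ∈ D) (k : ℕ) :
    p.coeff k ∈ D := by
  by_contra hk
  -- A functional that vanishes on `D` but not at the coefficient turns `p` into a complex
  -- polynomial with only zero values, hence with zero coefficients.
  obtain ⟨f, hf, hD⟩ := Submodule.exists_le_ker_of_notMem hk
  set q : Polynomial ℂ := ∑ i ∈ Finset.range (p.natDegree + 1),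
    Polynomial.C (f (p.coeff i)) * Polynomial.X ^ i with hq
  have hq0 : q = 0 := by
    refine Polynomial.funext fun t => ?_
    have h1 : f (p.eval (algebraMap ℂ A t)) = 0 := hD (h t)
    rw [Polynomial.eval_eq_sum_range, map_sum] at h1
    rw [hq, Polynomial.eval_finsetSum, Polynomial.eval_zero, ← h1]
    refine Finset.sum_congr rfl fun i _ => ?_
    rw [← map_pow, mul_comm (p.coeff i), ← Algebra.smul_def, map_smul, smul_eq_mul,
      Polynomial.eval_C_mul, Polynomial.eval_pow, Polynomial.eval_X, mul_comm]
  have h2 : q.coeff k = f (p.coeff k) := by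
    rw [hq, Polynomial.finsetSum_coeff]
    simp only [Polynomial.coeff_C_mul, Polynomial.coeff_X_pow, mul_ite, mul_one, mul_zero,
      Finset.sum_ite_eq]
    split_ifs with hk'
    · rfl
    · rw [Polynomial.coeff_eq_zero_of_natDegree_lt, map_zero]
      simpa using hk'
  exact hf (by rw [← h2, hq0, Polynomial.coeff_zero])

section
open Polynomial

theorem Polynomial.coeff_one_quadratic_pow {A : Type*} [CommRing A] (a b c : A) (l : ℕ) :
    ((C a + C b * X + C c * X ^ 2) ^ (l + 1)).coeff 1 = (l + 1) * (a ^ l * b) := by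
  have h := coeff_derivative ((C a + C b * X + C c * X ^ 2) ^ (l + 1)) 0
  rw [coeff_zero_eq_eval_zero, derivative_pow] at h
  simp at h
  rw [← h]
  ring

theorem Polynomial.coeff_two_quadratic_pow {A : Type*} [CommRing A] (a b c : A) (l : ℕ) :
    2 * ((C a + C b * X + C c * X ^ 2) ^ (l + 2)).coeff 2 =
      (l + 2) * ((l + 1) * (a ^ l * b ^ 2) + 2 * (a ^ (l + 1) * c)) := by
  have h := coeff_derivative ((C a + C b * X + C c * X ^ 2) ^ (l + 2)) 1
  have h' := coeff_derivative (derivative ((C a + C b * X + C c * X ^ 2) ^ (l + 2))) 0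
  rw [h, coeff_zero_eq_eval_zero, derivative_pow, derivative_mul, derivative_mul,
    derivative_pow] at h'
  simp at h'
  linear_combination -h'

end

section
variable {n : ℕ}

/-- The linear form `x ↦ ∑ a_s x_s` on the sphere. -/
noncomputable def sphereLin (n : ℕ) : (Fin (n + 1) → ℂ) →ₗ[ℂ] C(UnitSphere n, ℂ) where
  toFun a := ⟨fun x => ∑ s, a s * (x.1 s : ℂ), by fun_prop⟩
  map_add' a b := by
    ext x
    simp [add_mul, Finset.sum_add_distrib]
  map_smul' c a := by
    ext x
    simp [Finset.mul_sum, mul_assoc]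

theorem sphereLin_apply (a : Fin (n + 1) → ℂ) (x : UnitSphere n) :
    sphereLin n a x = ∑ s, a s * (x.1 s : ℂ) := rfl

/-- The span of the powers of null linear forms on the sphere. -/
noncomputable def nullPowerSpan (n : ℕ) : Submodule ℂ C(UnitSphere n, ℂ) :=
  Submodule.span ℂ {f | ∃ (a : Fin (n + 1) → ℂ) (l : ℕ), a ⬝ᵥ a = 0 ∧ f = sphereLin n a ^ l}

theorem sphereLin_pow_mem {a : Fin (n + 1) → ℂ} (ha : a ⬝ᵥ a = 0) (l : ℕ) :
    sphereLin n a ^ l ∈ nullPowerSpan n :=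
  Submodule.subset_span ⟨a, l, ha, rfl⟩

theorem sum_smul_sphereLin_single (a : Fin (n + 1) → ℂ) :
    ∑ s, a s • sphereLin n (Pi.single s 1) = sphereLin n a := by
  ext x
  simp [sphereLin_apply, Pi.single_apply]

theorem sum_sphereLin_single_sq : ∑ s, sphereLin n (Pi.single s 1) ^ 2 = 1 := by
  ext x
  have h : ‖x.1‖ ^ 2 = 1 := by simp
  rw [EuclideanSpace.norm_sq_eq] at h
  simp only [ContinuousMap.sum_apply, ContinuousMap.pow_apply, sphereLin_apply,
    ContinuousMap.one_apply, Pi.single_apply, ite_mul, one_mul, zero_mul, Finset.sum_ite_eq',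
    Finset.mem_univ, if_true]
  simp only [Real.norm_eq_abs, sq_abs] at h
  exact_mod_cast h

/-- The null parabola through `a` in the direction `g`. -/
theorem null_parabola {a b g : Fin (n + 1) → ℂ} (ha : a ⬝ᵥ a = 0) (hb : b ⬝ᵥ b = 0)
    (hga : g ⬝ᵥ a = 0) (hgb : g ⬝ᵥ b = 0) {κ : ℂ} (hκ : g ⬝ᵥ g = 2 * κ * (a ⬝ᵥ b)) (t : ℂ) :
    (a + t • g - (t ^ 2 * κ) • b) ⬝ᵥ (a + t • g - (t ^ 2 * κ) • b) = 0 := by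
  have h1 := dotProduct_comm a g
  have h2 := dotProduct_comm b a
  have h3 := dotProduct_comm b g
  simp only [add_dotProduct, sub_dotProduct, dotProduct_add, dotProduct_sub, smul_dotProduct,
    dotProduct_smul, smul_eq_mul, h1, h2, h3, ha, hb, hga, hgb, hκ]
  ring

theorem eval_parabola_mem {a b g : Fin (n + 1) → ℂ} (ha : a ⬝ᵥ a = 0) (hb : b ⬝ᵥ b = 0)
    (hga : g ⬝ᵥ a = 0) (hgb : g ⬝ᵥ b = 0) {κ : ℂ} (hκ : g ⬝ᵥ g = 2 * κ * (a ⬝ᵥ b)) (l k : ℕ) :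
    (((Polynomial.C (sphereLin n a) + Polynomial.C (sphereLin n g) * Polynomial.X +
      Polynomial.C (-κ • sphereLin n b) * Polynomial.X ^ 2) ^ l).coeff k) ∈ nullPowerSpan n := by
  refine Submodule.coeff_mem_of_forall_eval_mem _ _ (fun t => ?_) k
  have h := sphereLin_pow_mem (null_parabola ha hb hga hgb hκ t) l
  convert! h using 1
  simp only [Polynomial.eval_pow, Polynomial.eval_add, Polynomial.eval_mul, Polynomial.eval_C,
    Polynomial.eval_X, map_sub, map_add, map_smul]
  congr 1
  rw [mul_comm _ (algebraMap ℂ C(UnitSphere n, ℂ) t), ← Algebra.smul_def,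
    mul_comm _ (algebraMap ℂ C(UnitSphere n, ℂ) t ^ 2), ← map_pow, ← Algebra.smul_def, smul_smul]
  ext x
  simp
  ring

/-- The coefficient of `t` in the `(l+1)`-st power along the null parabola. -/
theorem sphereLin_pow_mul_tangent_mem {a b g : Fin (n + 1) → ℂ} (ha : a ⬝ᵥ a = 0)
    (hb : b ⬝ᵥ b = 0) (hab : a ⬝ᵥ b ≠ 0) (hga : g ⬝ᵥ a = 0) (hgb : g ⬝ᵥ b = 0) (l : ℕ) :
    sphereLin n a ^ l * sphereLin n g ∈ nullPowerSpan n := by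
  have h := eval_parabola_mem (κ := (g ⬝ᵥ g) / (2 * (a ⬝ᵥ b))) ha hb hga hgb (by field_simp)
    (l + 1) 1
  rw [Polynomial.coeff_one_quadratic_pow] at h
  have hl : ((l : ℂ) + 1) ≠ 0 := by exact_mod_cast l.succ_ne_zero
  refine (Submodule.smul_mem_iff _ hl).1 ?_
  convert! h using 1

/-- The coefficient of `t²` in the `(l+2)`-nd power along the null parabola, up to a nonzero scalar.
-/
theorem sphereLin_pow_mul_sq_sub_mem {a b g : Fin (n + 1) → ℂ} (ha : a ⬝ᵥ a = 0)
    (hb : b ⬝ᵥ b = 0) (hab : a ⬝ᵥ b ≠ 0) (hga : g ⬝ᵥ a = 0) (hgb : g ⬝ᵥ b = 0) (l : ℕ) :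
    ((l : ℂ) + 1) • (sphereLin n a ^ l * sphereLin n g ^ 2) -
      ((g ⬝ᵥ g) / (a ⬝ᵥ b)) • (sphereLin n a ^ (l + 1) * sphereLin n b) ∈ nullPowerSpan n := by
  have h := eval_parabola_mem (κ := (g ⬝ᵥ g) / (2 * (a ⬝ᵥ b))) ha hb hga hgb (by field_simp)
    (l + 2) 2
  have h2 := Polynomial.coeff_two_quadratic_pow (sphereLin n a) (sphereLin n g)
    (-((g ⬝ᵥ g) / (2 * (a ⬝ᵥ b))) • sphereLin n b) l
  have hl : ((l : ℂ) + 2) ≠ 0 := by exact_mod_cast (l + 1).succ_ne_zero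
  refine (Submodule.smul_mem_iff _ hl).1 ?_
  convert! (nullPowerSpan n).smul_mem (2 : ℂ) h using 1
  have h3 : (g ⬝ᵥ g) / (a ⬝ᵥ b) = 2 * ((g ⬝ᵥ g) / (2 * (a ⬝ᵥ b))) := by field_simp
  rw [h3]
  ext x
  have h5 := DFunLike.congr_fun h2 x
  simp only [ContinuousMap.mul_apply, ContinuousMap.add_apply, ContinuousMap.smul_apply,
    ContinuousMap.sub_apply, smul_eq_mul,
    show (2 : C(UnitSphere n, ℂ)) x = 2 from rfl,
    show (1 : C(UnitSphere n, ℂ)) x = 1 from rfl,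
    show (l : C(UnitSphere n, ℂ)) x = l from rfl] at h5 ⊢
  linear_combination -h5


theorem sum_sub_sub_sq {ι : Type*} [Fintype ι] (e a b : ι → ℂ) (N X W : ℂ) :
    ∑ s, (e s - b s / N * X - a s / N * W) ^ 2 =
      ∑ s, e s ^ 2 - 2 / N * X * ∑ s, b s * e s - 2 / N * W * ∑ s, a s * e s +
        (X / N) ^ 2 * ∑ s, b s ^ 2 + (W / N) ^ 2 * ∑ s, a s ^ 2 +
        2 * X * W / N ^ 2 * ∑ s, a s * b s := by
  simp only [Finset.mul_sum, ← Finset.sum_add_distrib, ← Finset.sum_sub_distrib]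
  exact Finset.sum_congr rfl fun s _ => by ring

-- With `b = star a`, the coordinate vector splits into multiples of `a` and `b` and a part `g s`
-- orthogonal to both. The `a` and `g s` parts are covered already. The `b` part (`hW`) follows by
-- summing the second order relation over `s`, because `∑ x_s² = 1` on the sphere expresses `∑ (g s
-- · x)²` through the product of the forms of `a` and `b`.
open scoped ComplexOrder in
theorem sphereLin_pow_mul_single_mem {a : Fin (n + 1) → ℂ} (ha : a ⬝ᵥ a = 0) (ha0 : a ≠ 0)
    (l : ℕ) (s : Fin (n + 1)) :
    sphereLin n a ^ l * sphereLin n (Pi.single s 1) ∈ nullPowerSpan n := by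
  set b : Fin (n + 1) → ℂ := star a with hbdef
  have hb : b ⬝ᵥ b = 0 := by
    rw [hbdef, Matrix.star_dotProduct_star, ha, star_zero]
  have hN : a ⬝ᵥ b ≠ 0 := by
    rw [hbdef, Ne, dotProduct_comm, dotProduct_star_self_eq_zero]
    exact ha0
  set N := a ⬝ᵥ b with hNdef
  have hN' : b ⬝ᵥ a = N := dotProduct_comm b a
  set g : Fin (n + 1) → Fin (n + 1) → ℂ :=
    fun s => Pi.single s 1 - (b s / N) • a - (a s / N) • b with hg
  have hga : ∀ s, g s ⬝ᵥ a = 0 := by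
    intro s
    simp only [hg, sub_dotProduct, smul_dotProduct, ha, hN', single_one_dotProduct, smul_eq_mul]
    field_simp
    ring
  have hgb : ∀ s, g s ⬝ᵥ b = 0 := by
    intro s
    simp only [hg, sub_dotProduct, smul_dotProduct, hb, ← hNdef, single_one_dotProduct,
      smul_eq_mul]
    field_simp
    ring
  have hgg : ∀ s, g s ⬝ᵥ g s = 1 - 2 * (a s * b s) / N := by
    intro s
    have h : g s ⬝ᵥ g s = g s ⬝ᵥ Pi.single s 1 := by
      conv_lhs => rw [hg]
      simp only [dotProduct_sub, dotProduct_smul]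
      rw [show (Pi.single s 1 - (b s / N) • a - (a s / N) • b) = g s from rfl, hga, hgb]
      simp
    rw [h, dotProduct_single_one]
    simp only [hg, Pi.sub_apply, Pi.smul_apply, Pi.single_eq_same, smul_eq_mul]
    ring
  -- This is the trace of the projection off the plane of `a` and `b`: `(n+1) - 2`.
  have hgsum : ∑ s, g s ⬝ᵥ g s = (n : ℂ) - 1 := by
    simp only [hgg, Finset.sum_sub_distrib, ← Finset.sum_div, ← Finset.mul_sum]
    rw [show ∑ i, a i * b i = N from rfl]
    simp
    field_simp
    ring
  have hY : ∀ s, sphereLin n (g s) = sphereLin n (Pi.single s 1) - (b s / N) • sphereLin n a -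
      (a s / N) • sphereLin n b := by
    intro s
    simp only [hg, map_sub, map_smul]
  have hYsum : ∑ s, sphereLin n (g s) ^ 2 =
      1 - (2 / N) • (sphereLin n a * sphereLin n b) := by
    ext x
    have h := congrArg (fun f => f x) (sum_sphereLin_single_sq (n := n))
    have ha' : ∑ s, a s ^ 2 = 0 := by
      rw [← ha]
      simp only [sq, dotProduct]
    have hb' : ∑ s, b s ^ 2 = 0 := by
      rw [← hb]
      simp only [sq, dotProduct]
    have hab' : ∑ s, a s * b s = N := rfl
    simp only [hY, ContinuousMap.sum_apply, ContinuousMap.pow_apply, ContinuousMap.sub_apply,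
      ContinuousMap.smul_apply, smul_eq_mul, ContinuousMap.one_apply, ContinuousMap.mul_apply]
      at h ⊢
    rw [sum_sub_sub_sq, h, ha', hb', hab']
    have hE : ∀ c : Fin (n + 1) → ℂ, ∑ s, c s * sphereLin n (Pi.single s 1) x =
        sphereLin n c x := by
      intro c
      rw [← sum_smul_sphereLin_single c]
      simp
    rw [hE, hE]
    field_simp
    ring
  have hW : ∀ l, sphereLin n a ^ l * sphereLin n b ∈ nullPowerSpan n := by
    intro l
    rcases l with _ | l
    · simpa using sphereLin_pow_mem hb 1
    · have h := Submodule.sum_mem _ fun s (_ : s ∈ Finset.univ) =>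
        sphereLin_pow_mul_sq_sub_mem ha hb hN (hga s) (hgb s) l
      rw [Finset.sum_sub_distrib, ← Finset.smul_sum, ← Finset.mul_sum, hYsum, ← Finset.sum_smul,
        ← Finset.sum_div, hgsum] at h
      have h1 := Submodule.sub_mem _
        ((nullPowerSpan n).smul_mem ((l : ℂ) + 1) (sphereLin_pow_mem ha l)) h
      -- After the sum over `s`, this scalar multiplies the wanted product `a^(l+1) b`; it equals
      -- `(2l+n+1)/N`.
      have h2 : (2 * ((l : ℂ) + 1) + (n - 1)) / N ≠ 0 := by
        refine div_ne_zero ?_ hN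
        have : (2 * ((l : ℂ) + 1) + (n - 1)) = ((2 * l + n + 1 : ℕ) : ℂ) := by
          push_cast
          ring
        rw [this]
        exact Nat.cast_ne_zero.2 (Nat.succ_ne_zero _)
      refine (Submodule.smul_mem_iff _ h2).1 ?_
      convert! h1 using 1
      rw [mul_sub, mul_one, mul_smul_comm, ← mul_assoc, ← pow_succ]
      module
  have h3 : sphereLin n a ^ l * sphereLin n (Pi.single s 1) =
      sphereLin n a ^ l * sphereLin n (g s) + (b s / N) • sphereLin n a ^ (l + 1) +
      (a s / N) • (sphereLin n a ^ l * sphereLin n b) := by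
    rw [hY, pow_succ, ← mul_smul_comm, ← mul_smul_comm, ← mul_add, ← mul_add]
    congr 1
    abel
  rw [h3]
  exact add_mem (add_mem (sphereLin_pow_mul_tangent_mem ha hb hN (hga s) (hgb s) l)
    (Submodule.smul_mem _ _ (sphereLin_pow_mem ha _))) (Submodule.smul_mem _ _ (hW l))

end

section
variable {n : ℕ}

theorem exists_null_ne_zero (hn : 1 ≤ n) : ∃ a : Fin (n + 1) → ℂ, a ⬝ᵥ a = 0 ∧ a ≠ 0 := by
  obtain ⟨n, rfl⟩ := Nat.exists_eq_add_of_le' hn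
  refine ⟨Pi.single 0 1 + Complex.I • Pi.single 1 1, ?_, fun h => ?_⟩
  · simp [dotProduct_add]
  · simpa using congrFun h 0

theorem single_mul_mem_nullPowerSpan (hn : 1 ≤ n) (s : Fin (n + 1)) {f : C(UnitSphere n, ℂ)}
    (hf : f ∈ nullPowerSpan n) : sphereLin n (Pi.single s 1) * f ∈ nullPowerSpan n := by
  induction hf using Submodule.span_induction with
  | mem f hf =>
    obtain ⟨a, l, ha, rfl⟩ := hf
    rw [mul_comm]
    by_cases ha0 : a = 0
    -- For `a = 0` and exponent `0` the power is the constant `1`, which is also the zeroth power of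
    -- a nonzero null vector.
    · rcases l with _ | l
      · obtain ⟨c, hc, hc0⟩ := exists_null_ne_zero hn
        simpa using sphereLin_pow_mul_single_mem hc hc0 0 s
      · simp [ha0]
    · exact sphereLin_pow_mul_single_mem ha ha0 l s
  | zero => simp
  | add f g _ _ hf hg =>
    rw [mul_add]
    exact add_mem hf hg
  | smul c f _ hf =>
    rw [mul_smul_comm]
    exact Submodule.smul_mem _ _ hf

theorem nullPowerSpan_topologicalClosure (hn : 1 ≤ n) :
    (nullPowerSpan n).topologicalClosure = ⊤ := by
  set S : Set C(UnitSphere n, ℂ) := Set.range fun s => sphereLin n (Pi.single s 1) with hS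
  have hstar : star S = S := by
    have h : ∀ s, star (sphereLin n (Pi.single s 1)) = sphereLin n (Pi.single s 1) := by
      intro s
      ext x
      simp [sphereLin_apply, Pi.single_apply]
    ext f
    rw [Set.mem_star]
    constructor
    · rintro ⟨s, hs⟩
      exact ⟨s, by simp only at hs ⊢; rw [← star_star f, ← hs, h]⟩
    · rintro ⟨s, rfl⟩
      exact ⟨s, (h s).symm⟩
  have hsep : (StarAlgebra.adjoin ℂ S).SeparatesPoints := by
    intro x y hxy
    by_contra! h
    apply hxy
    ext s
    have := h _ ⟨sphereLin n (Pi.single s 1), StarAlgebra.subset_adjoin ℂ S ⟨s, rfl⟩, rfl⟩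
    simpa [sphereLin_apply, Pi.single_apply] using this
  have hsub : ∀ f ∈ StarAlgebra.adjoin ℂ S, f ∈ nullPowerSpan n := by
    intro f hf
    have hf' : f ∈ Algebra.adjoin ℂ S := by
      have h : f ∈ (StarAlgebra.adjoin ℂ S).toSubalgebra := hf
      rwa [StarAlgebra.adjoin_toSubalgebra, hstar, Set.union_self] at h
    clear hf
    -- The span is not known to be closed under products, so the induction shows that `f` acts on it
    -- by multiplication; applying `f` to `1` then gives the claim.
    have key : ∀ g ∈ nullPowerSpan n, f * g ∈ nullPowerSpan n := by
      induction hf' using Algebra.adjoin_induction with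
      | mem f hf =>
        obtain ⟨s, rfl⟩ := hf
        exact fun g hg => single_mul_mem_nullPowerSpan hn s hg
      | algebraMap r =>
        intro g hg
        rw [← Algebra.smul_def]
        exact Submodule.smul_mem _ _ hg
      | add f₁ f₂ _ _ h₁ h₂ =>
        intro g hg
        rw [add_mul]
        exact add_mem (h₁ g hg) (h₂ g hg)
      | mul f₁ f₂ _ _ h₁ h₂ =>
        intro g hg
        rw [mul_assoc]
        exact h₁ _ (h₂ g hg)
    have h1 : (1 : C(UnitSphere n, ℂ)) ∈ nullPowerSpan n := by
      simpa using sphereLin_pow_mem (n := n) (a := 0) (by simp) 0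
    simpa using key 1 h1
  have h := ContinuousMap.starSubalgebra_topologicalClosure_eq_top_of_separatesPoints _ hsep
  rw [eq_top_iff]
  intro f _
  have hf : f ∈ (StarAlgebra.adjoin ℂ S).topologicalClosure := by
    rw [h]
    trivial
  exact closure_mono hsub hf

/-- The span of the powers of null linear forms is dense in `L²(S^n)`. -/
theorem dense_map_nullPowerSpan (hn : 1 ≤ n) :
    Dense (((nullPowerSpan n).map (ContinuousMap.toLp 2 (sphereMeasure n) ℂ :
      C(UnitSphere n, ℂ) →L[ℂ] L2Sphere n).toLinearMap : Submodule ℂ (L2Sphere n)) :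
        Set (L2Sphere n)) := by
  rw [Submodule.dense_iff_topologicalClosure_eq_top]
  exact (ContinuousMap.toLp_denseRange ℂ (sphereMeasure n) ℂ
    (by norm_num)).topologicalClosure_map_submodule (nullPowerSpan_topologicalClosure hn)

end

/-! ### Extension of a resolution of the identity from a dense subspace. -/

section
open Filter Topology
variable {H X : Type*} [NormedAddCommGroup H] [InnerProductSpace ℂ H] [MeasurableSpace X]
  {μ : Measure X}

/-- A resolution of the identity that holds on a dense subspace holds everywhere. -/
theorem resolution_of_identity_of_dense (Φ : X → H) {D : Submodule ℂ H} (hD : Dense (D : Set H))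
    (hmem : ∀ φ ∈ D, MemLp (fun z => inner ℂ (Φ z) φ) 2 μ)
    (hinner : ∀ φ ∈ D, ∀ ψ ∈ D,
      ∫ z, inner ℂ (Φ z) φ * conj (inner ℂ (Φ z) ψ) ∂μ = inner ℂ ψ φ) (φ ψ : H) :
    Integrable (fun z => inner ℂ (Φ z) φ * conj (inner ℂ (Φ z) ψ)) μ ∧
      ∫ z, inner ℂ (Φ z) φ * conj (inner ℂ (Φ z) ψ) ∂μ = inner ℂ ψ φ := by
  have hint : ∀ {f g : X → ℂ} (hf : MemLp f 2 μ) (hg : MemLp g 2 μ),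
      inner ℂ (hg.toLp g) (hf.toLp f) = ∫ z, f z * conj (g z) ∂μ := by
    intro f g hf hg
    rw [L2.inner_def]
    refine integral_congr_ae ?_
    filter_upwards [hf.coeFn_toLp, hg.coeFn_toLp] with z h1 h2
    rw [h1, h2]
    rfl
  have hnorm : ∀ φ ∈ D, eLpNorm (fun z => inner ℂ (Φ z) φ) 2 μ = ‖φ‖ₑ := by
    intro φ hφ
    rw [← Lp.enorm_toLp (hf := hmem φ hφ)]
    rw [enorm_eq_iff_norm_eq, ← sq_eq_sq₀ (norm_nonneg _) (norm_nonneg _),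
      ← inner_self_eq_norm_sq (𝕜 := ℂ), ← inner_self_eq_norm_sq (𝕜 := ℂ), hint, hinner φ hφ φ hφ]
  have hall : ∀ φ : H, MemLp (fun z => inner ℂ (Φ z) φ) 2 μ ∧
      eLpNorm (fun z => inner ℂ (Φ z) φ) 2 μ ≤ ‖φ‖ₑ := by
    -- Fatou's lemma along a sequence in `D` converging to `φ`: the coefficient functions converge
    -- pointwise and have norms `‖u k‖`.
    intro φ
    obtain ⟨u, huD, hu⟩ := mem_closure_iff_seq_limit.1 (hD φ)
    have hlim : ∀ z, Tendsto (fun k => (inner ℂ (Φ z) (u k) : ℂ)) atTop (𝓝 (inner ℂ (Φ z) φ)) :=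
      fun z => tendsto_const_nhds.inner hu
    have hle : eLpNorm (fun z => (inner ℂ (Φ z) φ : ℂ)) 2 μ ≤ ‖φ‖ₑ := by
      refine (Lp.eLpNorm_lim_le_liminf_eLpNorm
        (fun k => (hmem (u k) (huD k)).aestronglyMeasurable) _
        (Eventually.of_forall hlim)).trans (le_of_eq ?_)
      simp only [hnorm _ (huD _)]
      exact hu.enorm.liminf_eq
    exact ⟨⟨aestronglyMeasurable_of_tendsto_ae atTop
      (fun k => (hmem (u k) (huD k)).aestronglyMeasurable) (Eventually.of_forall hlim),
      hle.trans_lt enorm_lt_top⟩, hle⟩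
  let U : H →L[ℂ] Lp ℂ 2 μ := LinearMap.mkContinuous
    { toFun := fun φ => (hall φ).1.toLp _
      map_add' := fun φ ψ => by
        rw [← MemLp.toLp_add]
        simp only [inner_add_right]
        rfl
      map_smul' := fun c φ => by
        rw [RingHom.id_apply, ← MemLp.toLp_const_smul]
        simp only [inner_smul_right]
        rfl } 1 (fun φ => by
        rw [one_mul]
        change ‖(hall φ).1.toLp _‖ ≤ _
        rw [Lp.norm_toLp]
        exact ENNReal.toReal_le_of_le_ofReal (norm_nonneg _) (by
          rw [ofReal_norm]
          exact (hall φ).2))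
  have hU : ∀ φ ψ, inner ℂ (U ψ) (U φ) =
      ∫ z, inner ℂ (Φ z) φ * conj (inner ℂ (Φ z) ψ) ∂μ := fun φ ψ => hint (hall φ).1 (hall ψ).1
  refine ⟨(hall φ).1.integrable_mul (hall ψ).1.star, ?_⟩
  rw [← hU]
  -- Both sides are continuous, so the identity extends from `D` first in `ψ` and then in `φ`.
  have h1 : ∀ φ ∈ D, ∀ ψ, inner ℂ (U ψ) (U φ) = inner ℂ ψ φ := fun φ hφ =>
    congrFun (Continuous.ext_on hD (by fun_prop) (by fun_prop) fun ψ hψ => by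
      rw [hU, hinner φ hφ ψ hψ])
  exact congrFun (Continuous.ext_on (f := fun φ => inner ℂ (U ψ) (U φ)) (g := fun φ => inner ℂ ψ φ)
    hD (by fun_prop) (by fun_prop) fun φ hφ => h1 φ hφ ψ) φ

end

/-! ### Pairing coherent states with null powers, and the conclusion. -/

/-- The class in `L²(S^n)` of the power `(∑ a_s x_s)^l`. -/
noncomputable def powerState (n : ℕ) (a : Fin (n + 1) → ℂ) (l : ℕ) : L2Sphere n :=
  ContinuousMap.toLp 2 (sphereMeasure n) ℂ (sphereLin n a ^ l)

/-- The real coefficient with which the `l`-th term of a coherent state pairs with null powers. -/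
noncomputable def pairingCoeff (n : ℕ) (ħ : ℝ) (l : ℕ) : ℝ :=
  Real.sqrt (2 * (l : ℝ) + (n : ℝ) - 1) / ((l.factorial : ℝ) * Real.sqrt ((n : ℝ) - 1)) / ħ ^ l *
    (l.factorial / ∏ j ∈ Finset.range l, ((n : ℝ) + 1 + 2 * j))

theorem sphereDot_conj {n : ℕ} (a : Fin (n + 1) → ℂ) (x : UnitSphere n) :
    sphereDot x (fun s => conj (a s)) = sphereLin n a x := by
  simp only [sphereDot, sphereLin_apply, Complex.conj_conj, mul_comm]

theorem inner_toLp_toLp {n : ℕ} (f g : C(UnitSphere n, ℂ)) :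
    (inner ℂ (ContinuousMap.toLp 2 (sphereMeasure n) ℂ f : L2Sphere n)
      (ContinuousMap.toLp 2 (sphereMeasure n) ℂ g : L2Sphere n) : ℂ) =
      ∫ x, g x * conj (f x) ∂(sphereMeasure n) := by
  rw [L2.inner_def]
  refine integral_congr_ae ?_
  filter_upwards [ContinuousMap.coeFn_toLp (p := 2) (𝕜 := ℂ) (sphereMeasure n) f,
    ContinuousMap.coeFn_toLp (p := 2) (𝕜 := ℂ) (sphereMeasure n) g] with x h1 h2
  rw [h1, h2]
  rfl

theorem sum_conj_sq {ι : Type*} [Fintype ι] {a : ι → ℂ} (ha : a ⬝ᵥ a = 0) :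
    ∑ s, conj (a s) ^ 2 = 0 := by
  rw [← map_zero conj, ← ha, dotProduct, map_sum]
  simp only [map_mul, sq]

theorem inner_powerState_powerState {n : ℕ} {a b : Fin (n + 1) → ℂ} (ha : a ⬝ᵥ a = 0)
    (hb : b ⬝ᵥ b = 0) (l k : ℕ) :
    inner ℂ (powerState n b k) (powerState n a l) =
      if l = k then l.factorial / (∏ j ∈ Finset.range l, ((n : ℂ) + 1 + 2 * j)) *
        (∑ s, conj (b s) * a s) ^ l else 0 := by
  have h := integral_sphereDot_pow (sum_conj_sq ha) (sum_conj_sq hb) l k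
  simp only [sphereDot_conj, Complex.conj_conj] at h
  rw [powerState, powerState, inner_toLp_toLp, ← h]
  rfl

/-- Termwise integration is justified by the uniform summable bound and the finite mass of the
sphere. -/
theorem integral_mul_conj_coherentFun {n : ℕ} {ħ : ℝ} (f : C(UnitSphere n, ℂ))
    (α : Fin (n + 1) → ℂ) :
    HasSum (fun l => ∫ x, f x * conj (coherentTerm n ħ α l x) ∂(sphereMeasure n))
      (∫ x, f x * conj (coherentFun n ħ α x) ∂(sphereMeasure n)) := by
  obtain ⟨u, hu, hb⟩ := coherentTerm_bound n ħ α
  have hc : ∀ l, Continuous fun x => f x * conj (coherentTerm n ħ α l x) := fun l =>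
    f.continuous.mul (Complex.continuous_conj.comp (continuous_coherentTerm n ħ α l))
  have hbd : ∀ l x, ‖f x * conj (coherentTerm n ħ α l x)‖ ≤ ‖f‖ * u l := by
    intro l x
    rw [norm_mul, RCLike.norm_conj]
    exact mul_le_mul (f.norm_coe_le_norm x) (hb l x) (norm_nonneg _) (norm_nonneg _)
  have hint : ∀ l, Integrable (fun x => f x * conj (coherentTerm n ħ α l x)) (sphereMeasure n) :=
    fun l => (hc l).integrable_of_hasCompactSupport (HasCompactSupport.of_compactSpace _)
  have h := hasSum_integral_of_summable_integral_norm hint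
    (Summable.of_nonneg_of_le (fun l => integral_nonneg fun x => norm_nonneg _)
      (fun l => (integral_mono (hint l).norm (integrable_const (‖f‖ * u l)) (hbd l)).trans
        (by simp)) (hu.mul_left ‖f‖))
  convert! h using 3 with x
  rw [tsum_mul_left]
  congr 1
  exact Complex.conj_tsum _

/-- Both `ρ(z)` and `conj a` are null, so orthogonality of degrees leaves only the `l`-th term of
the series. -/
theorem inner_coherentState_powerState (c : SphereCase) {ħ : ℝ} {a : Fin (c.n + 1) → ℂ}
    (ha : a ⬝ᵥ a = 0) (l : ℕ) (z : Fin c.m → ℂ) :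
    inner ℂ (coherentState c ħ z) (powerState c.n a l) =
      pairingCoeff c.n ħ l * (∑ s, c.rho z s * a s) ^ l := by
  rw [coherentState, powerState, inner_toLp_toLp]
  have h := integral_mul_conj_coherentFun (ħ := ħ) (sphereLin c.n a ^ l) (c.rho z)
  refine h.unique ?_
  have hterm : ∀ k, ∫ x, (sphereLin c.n a ^ l) x *
      conj (coherentTerm c.n ħ (c.rho z) k x) ∂(sphereMeasure c.n) =
      if k = l then pairingCoeff c.n ħ l * (∑ s, c.rho z s * a s) ^ l else 0 := by
    intro k
    have h1 := integral_sphereDot_pow (sum_conj_sq ha) (c.sum_rho_sq z) l k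
    simp only [sphereDot_conj, Complex.conj_conj] at h1
    have h2 : ∀ x, (sphereLin c.n a ^ l) x * conj (coherentTerm c.n ħ (c.rho z) k x) =
        ((Real.sqrt (2 * (k : ℝ) + (c.n : ℝ) - 1) /
          ((k.factorial : ℝ) * Real.sqrt ((c.n : ℝ) - 1)) / ħ ^ k : ℝ) : ℂ) *
        (sphereLin c.n a x ^ l * conj (sphereDot x (c.rho z) ^ k)) := by
      intro x
      rw [coherentTerm, map_mul, Complex.conj_ofReal, ContinuousMap.pow_apply, div_pow, map_div₀,
        ← Complex.ofReal_pow, Complex.conj_ofReal]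
      push_cast
      ring
    simp_rw [h2]
    rw [integral_const_mul, h1]
    by_cases hk : k = l
    · subst hk
      rw [if_pos rfl, if_pos rfl, pairingCoeff]
      push_cast
      ring
    · rw [if_neg (Ne.symm hk), if_neg hk, mul_zero]
  simp_rw [hterm]
  exact hasSum_ite_eq l _

/-- This is what the weights `√(2l+n-1)/√(n-1)` are made for: by telescoping, `∏ (n+1+2j) / ∏
(n-1+2j) = (2l+n-1)/(n-1)`. -/
theorem pairingCoeff_sq {n : ℕ} (hn : 2 ≤ n) {ħ : ℝ} (hħ : 0 < ħ) (l : ℕ) :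
    pairingCoeff n ħ l ^ 2 * (ħ ^ (2 * l) * l.factorial *
      ∏ j ∈ Finset.range l, ((n : ℝ) - 1 + 2 * j)) =
      l.factorial / ∏ j ∈ Finset.range l, ((n : ℝ) + 1 + 2 * j) := by
  have hn' : (2 : ℝ) ≤ n := by exact_mod_cast hn
  have htel : ∀ l : ℕ, (2 * (l : ℝ) + n - 1) * ∏ j ∈ Finset.range l, ((n : ℝ) - 1 + 2 * j) =
      ((n : ℝ) - 1) * ∏ j ∈ Finset.range l, ((n : ℝ) + 1 + 2 * j) := by
    intro l
    induction l with
    | zero => simp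
    | succ l ih =>
      rw [Finset.prod_range_succ, Finset.prod_range_succ, ← mul_assoc ((n : ℝ) - 1), ← ih]
      push_cast
      ring
  have hP : ∏ j ∈ Finset.range l, ((n : ℝ) + 1 + 2 * j) ≠ 0 :=
    (Finset.prod_pos fun j _ => by positivity).ne'
  have h1 : Real.sqrt (2 * (l : ℝ) + (n : ℝ) - 1) ^ 2 = 2 * (l : ℝ) + (n : ℝ) - 1 :=
    Real.sq_sqrt (by have : (0 : ℝ) ≤ l := l.cast_nonneg
                     linarith)
  have h2 : Real.sqrt ((n : ℝ) - 1) ^ 2 = n - 1 := Real.sq_sqrt (by linarith)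
  have h3 : (n : ℝ) - 1 ≠ 0 := by linarith
  have h4 : (l.factorial : ℝ) ≠ 0 := by positivity
  rw [pairingCoeff, mul_pow, div_pow, div_pow, mul_pow, h1, h2]
  field_simp
  linear_combination ħ ^ (l * 2) * htel l

theorem SphereCase.two_le_n (c : SphereCase) : 2 ≤ c.n := by
  rcases c <;> decide

theorem SphereCase.one_le_m (c : SphereCase) : 1 ≤ c.m := by
  rcases c <;> decide

/-- The resolution of the identity for powers of null linear forms. -/
theorem integral_inner_powerState (c : SphereCase) {ħ : ℝ} (hħ : 0 < ħ)
    {a b : Fin (c.n + 1) → ℂ} (ha : a ⬝ᵥ a = 0) (hb : b ⬝ᵥ b = 0) (l k : ℕ) :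
    ∫ z, inner ℂ (coherentState c ħ z) (powerState c.n a l) *
        conj (inner ℂ (coherentState c ħ z) (powerState c.n b k)) ∂(bargmannMeasure c.m ħ) =
      inner ℂ (powerState c.n b k) (powerState c.n a l) := by
  have h := c.integral_rho_pow hħ (sum_conj_sq ha) (fun s => conj (b s)) l k
  simp only [Complex.conj_conj] at h
  have h2 : ∀ z, inner ℂ (coherentState c ħ z) (powerState c.n a l) *
      conj (inner ℂ (coherentState c ħ z) (powerState c.n b k)) =
      (pairingCoeff c.n ħ l * pairingCoeff c.n ħ k : ℝ) * ((∑ s, c.rho z s * a s) ^ l *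
        conj ((∑ s, c.rho z s * b s) ^ k)) := by
    intro z
    rw [inner_coherentState_powerState c ha, inner_coherentState_powerState c hb, map_mul,
      Complex.conj_ofReal]
    push_cast
    ring
  simp_rw [h2]
  rw [integral_const_mul, h, inner_powerState_powerState ha hb]
  split_ifs with hlk
  · subst hlk
    have h3 := congrArg (fun r : ℝ => (r : ℂ)) (pairingCoeff_sq c.two_le_n hħ l)
    push_cast at h3 ⊢
    rw [← h3]
    ring
  · rw [mul_zero]

theorem memLp_inner_powerState (c : SphereCase) {ħ : ℝ} (hħ : 0 < ħ)
    {a : Fin (c.n + 1) → ℂ} (ha : a ⬝ᵥ a = 0) (l : ℕ) :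
    MemLp (fun z => inner ℂ (coherentState c ħ z) (powerState c.n a l)) 2
      (bargmannMeasure c.m ħ) := by
  have h := (c.memLp_rho_pow hħ (fun s => conj (a s)) l).const_mul (pairingCoeff c.n ħ l : ℂ)
  simpa only [inner_coherentState_powerState c ha, Complex.conj_conj] using h

/-- The coherent states resolve the identity of `L²(S^n)`. -/
theorem coherentState_resolution (c : SphereCase) {ħ : ℝ} (hħ : 0 < ħ) (φ ψ : L2Sphere c.n) :
    Integrable (fun z => inner ℂ (coherentState c ħ z) φ * conj (inner ℂ (coherentState c ħ z) ψ))
        (bargmannMeasure c.m ħ) ∧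
      ∫ z, inner ℂ (coherentState c ħ z) φ * conj (inner ℂ (coherentState c ħ z) ψ)
        ∂(bargmannMeasure c.m ħ) = inner ℂ ψ φ := by
  have hspan : (nullPowerSpan c.n).map (ContinuousMap.toLp 2 (sphereMeasure c.n) ℂ :
      C(UnitSphere c.n, ℂ) →L[ℂ] L2Sphere c.n).toLinearMap =
      Submodule.span ℂ {φ | ∃ (a : Fin (c.n + 1) → ℂ) (l : ℕ), a ⬝ᵥ a = 0 ∧
        φ = powerState c.n a l} := by
    rw [nullPowerSpan, Submodule.map_span]
    congr 1
    ext φ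
    constructor
    · rintro ⟨f, ⟨a, l, ha, rfl⟩, rfl⟩
      exact ⟨a, l, ha, rfl⟩
    · rintro ⟨a, l, ha, rfl⟩
      exact ⟨_, ⟨a, l, ha, rfl⟩, rfl⟩
  have hD := dense_map_nullPowerSpan (n := c.n) (by have := c.two_le_n; omega)
  rw [hspan] at hD
  have hmem : ∀ φ ∈ Submodule.span ℂ {φ | ∃ (a : Fin (c.n + 1) → ℂ) (l : ℕ), a ⬝ᵥ a = 0 ∧
      φ = powerState c.n a l}, MemLp (fun z => inner ℂ (coherentState c ħ z) φ) 2
        (bargmannMeasure c.m ħ) := by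
    intro φ hφ
    induction hφ using Submodule.span_induction with
    | mem φ hφ =>
      obtain ⟨a, l, ha, rfl⟩ := hφ
      exact memLp_inner_powerState c hħ ha l
    | zero => simp
    | add φ ψ _ _ h1 h2 =>
      simp only [inner_add_right]
      exact h1.add h2
    | smul r φ _ h1 =>
      simp only [inner_smul_right]
      exact h1.const_mul r
  refine resolution_of_identity_of_dense _ hD hmem ?_ φ ψ
  intro φ hφ ψ hψ
  have hint : ∀ φ ∈ _, ∀ ψ ∈ _, Integrable (fun z => inner ℂ (coherentState c ħ z) φ *
      conj (inner ℂ (coherentState c ħ z) ψ)) (bargmannMeasure c.m ħ) :=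
    fun φ hφ ψ hψ => (hmem φ hφ).integrable_mul (hmem ψ hψ).star
  induction hφ using Submodule.span_induction with
  | mem φ hφ' =>
    have hφ := Submodule.subset_span (R := ℂ) hφ'
    obtain ⟨a, l, ha, rfl⟩ := hφ'
    induction hψ using Submodule.span_induction with
    | mem ψ hψ' =>
      obtain ⟨b, k, hb, rfl⟩ := hψ'
      exact integral_inner_powerState c hħ ha hb l k
    | zero => simp
    | add ψ₁ ψ₂ hψ₁ hψ₂ h1 h2 =>
      simp only [inner_add_right, inner_add_left, map_add, mul_add]
      rw [integral_add (hint _ hφ _ hψ₁) (hint _ hφ _ hψ₂), h1, h2]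
    | smul r ψ _ h1 =>
      simp only [inner_smul_right, inner_smul_left, map_mul, mul_left_comm _ (conj r)]
      rw [integral_const_mul, h1]
  | zero => simp
  | add φ₁ φ₂ hφ₁ hφ₂ h1 h2 =>
    simp only [inner_add_right, add_mul]
    rw [integral_add (hint _ hφ₁ _ hψ) (hint _ hφ₂ _ hψ), h1, h2]
  | smul r φ _ h1 =>
    simp only [inner_smul_right, mul_assoc]
    rw [integral_const_mul, h1]

theorem ae_ne_zero_bargmannMeasure {m : ℕ} (hm : 1 ≤ m) (ħ : ℝ) :
    ∀ᵐ z ∂(bargmannMeasure m ħ), z ≠ 0 := by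
  have : Nonempty (Fin m) := ⟨⟨0, hm⟩⟩
  exact (withDensity_absolutelyContinuous _ _).ae_le (Measure.ae_ne volume 0)

theorem mainTheorem6 (c : SphereCase) (ħ : ℝ) (hħ : 0 < ħ) :
    (Submodule.span ℂ (coherentState c ħ '' {z : Fin c.m → ℂ | z ≠ 0})).topologicalClosure = ⊤ ∧
    ∀ φ ψ : L2Sphere c.n,
      Integrable
        (fun z : Fin c.m → ℂ =>
          sphereInner φ (coherentState c ħ z) * sphereInner (coherentState c ħ z) ψ)
        (bargmannMeasure c.m ħ) ∧
      sphereInner φ ψ =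
        ∫ z : Fin c.m → ℂ,
          sphereInner φ (coherentState c ħ z) * sphereInner (coherentState c ħ z) ψ
          ∂(bargmannMeasure c.m ħ) := by
  have hconj : ∀ φ ψ : L2Sphere c.n, inner ℂ φ ψ = conj (inner ℂ ψ φ : ℂ) :=
    fun φ ψ => (inner_conj_symm φ ψ).symm
  constructor
  -- For `ψ` in the orthogonal complement, the resolution writes `⟨ψ, ψ⟩` as an integral of a
  -- function that vanishes off `z = 0`, a null set.
  · rw [Submodule.topologicalClosure_eq_top_iff, Submodule.eq_bot_iff]
    intro ψ hψ
    rw [← inner_self_eq_zero (𝕜 := ℂ), ← (coherentState_resolution c hħ ψ ψ).2]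
    refine integral_eq_zero_of_ae ?_
    filter_upwards [ae_ne_zero_bargmannMeasure c.one_le_m ħ] with z hz
    rw [(Submodule.mem_orthogonal _ _).1 hψ _ (Submodule.subset_span ⟨z, hz, rfl⟩), zero_mul]
    rfl
  · intro φ ψ
    simp only [sphereInner_eq_inner]
    have h := coherentState_resolution c hħ φ ψ
    simp only [← hconj] at h
    exact ⟨h.1, h.2.symm⟩
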